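/- **Trees and forests.** For a set $\Omega$, an $\Omega$-decorated rooted forest is a finite disjoint union of (nonempty, finite, non-planar) rooted trees with vertices decorated by $\Omega$, up to isomorphism. Let $\mathcal F_\Omega$ be the commutative real algebra freely generated by $\Omega$-decorated rooted trees, i.e. the linear span of forests with the concatenation product and unit the empty forest $\emptyset$. For $a\in\Omega$ the grafting $B_+^a(F)$ joins the roots of all trees of $F$ to a new root decorated by $a$; it is extended linearly. **Shuffles of trees.** Let $(\Omega,\bullet)$ be a commutative semigroup and $\lambda\in\mathbb R$. The bilinear product $⧢_\lambda$ on $\mathcal F_\Omega$ is defined recursively on forests by $\emptyset ⧢_\lambda F=F⧢_\lambda\emptyset=F$; for two trees, $$B_+^a(f)⧢_\lambda B_+^{b}(g)=B_+^a\big(f⧢_\lambda B_+^{b}(g)\big)+B_+^{b}\big(B_+^a(f)⧢_\lambda g\big)+\lambda B_+^{a\bullet b}(f⧢_\lambda g);$$ and for forests $F=T_1\cdots T_k$, $F'=t_1\cdots t_n$ with $k,n\ge 1$, $k+n\ge3$, $$F⧢_\lambda F'=\frac1{kn}\sum_{i=1}^k\sum_{j=1}^n (T_i⧢_\lambda t_j)\prod_{p\ne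 i}T_p\prod_{q\neq j}t_q .$$ For $\lambda=0$ no product on $\Omega$ is needed. On $\mathcal F_{\mathbb N^*}$, with $\mathbb N^*=\{1,2,\dots\}$ and $\bullet=+$, $⧢_1$ is the stuffle and $⧢_{-1}$ the anti-stuffle product; on $\mathcal F_{\{x,y\}}$, $⧢=⧢_0$ is the shuffle product. **Stuffle arborified zeta values.** Let $\mathcal Z_{-1},\mathcal Z_0$ be the algebra morphisms (for concatenation) from $\mathcal F_{\mathbb N^*}$ to the real sequences with the pointwise product determined by $$\mathcal Z_{-1}(B_+^a(F))(N)=\sum_{1\le n<N}\frac{\mathcal Z_{-1}(F)(n)}{n^a},\qquad \mathcal Z_0(B_+^a(F))(N)=\sum_{1\le n\le N}\frac{\mathcal Z_0(F)(n)}{n^a}$$ for all forests $F$. Let $\mathcal F^{\rm conv}_{\mathbb N^*}$ be the span of the forests all of whose roots have decoration $\ge2$, and set $\zeta^T_{\rm stuffle}(v)=\lim_{N\to\infty}\mathcal Z_{-1}(v)(N)$ and $\zeta^{T,\star}_{\rm stuffle}(v)=\lim_{N\to\infty}\mathcal Z_{0}(v)(N)$ for $v\in\mathcal F^{\rm conv}_{\mathbb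 N^*}$. **Shuffle arborified zeta values.** Let $\sigma_x(t)=1/t$ and $\sigma_y(t)=1/(1-t)$. For $0<\epsilon<1$ let $I_\epsilon$ be the algebra morphism (for concatenation) from $\mathcal F_{\{x,y\}}$ to functions on $[\epsilon,1)$ determined by $I_\epsilon(B_+^a(F))(z)=\int_\epsilon^z\sigma_a(t)\,I_\epsilon(F)(t)\,dt$ for all forests $F$. Let $\mathcal F^{\rm conv}_{\{x,y\}}$ be the span of the forests whose leaves and branching vertices (vertices with at least two direct successors) are all decorated by $y$ and whose roots are all decorated by $x$. For $v\in\mathcal F^{\rm conv}_{\{x,y\}}$ set $Li^T_v(z)=\lim_{\epsilon\to0^+}I_\epsilon(v)(z)$ for $0<z<1$, and $\zeta^T_{\rm shuffle}(v)=\lim_{z\to1^-}Li^T_v(z)$. **Theorem.** All the above limits exist and are finite. $\mathcal F^{\rm conv}_{\mathbb N^*}$ contains $\emptyset$ and is stable under the stuffle and the anti-stuffle products, and $\mathcal F^{\rm conv}_{\{x,y\}}$ contains $\emptyset$ and is stable under the shuffle product. The map $\zeta^T_{\rm stuffle}:\mathcal F^{\rm conv}_{\mathbb N^*}\to\mathbb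 R$ (resp. $\zeta^{T,\star}_{\rm stuffle}:\mathcal F^{\rm conv}_{\mathbb N^*}\to\mathbb R$, resp. $\zeta^T_{\rm shuffle}:\mathcal F^{\rm conv}_{\{x,y\}}\to\mathbb R$) is an algebra morphism for the stuffle (resp. anti-stuffle, resp. shuffle) product on trees: it is linear, sends $\emptyset$ to $1$, and sends the tree product of any two elements to the product of their images. -/

import Mathlib

open Filter Topology

namespace ArboZeta

/-! ### Rooted trees and forests -/

/-- Planar rooted trees whose vertices are decorated by elements of `Ω`. -/
inductive PlanarTree (Ω : Type*) where
  | node (a : Ω) (l : List (PlanarTree Ω)) : PlanarTree Ω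

/-- Elementary moves between planar trees that represent the same rooted tree: permute the
direct successors of the root, or perform a move in the subtree above one of them. -/
inductive PlanarTree.Move {Ω : Type*} : PlanarTree Ω → PlanarTree Ω → Prop where
  | perm (a : Ω) {l l' : List (PlanarTree Ω)} (h : l.Perm l') :
      PlanarTree.Move (PlanarTree.node a l) (PlanarTree.node a l')
  | child (a : Ω) (l₁ l₂ : List (PlanarTree Ω)) {t t' : PlanarTree Ω}
      (h : PlanarTree.Move t t') :
      PlanarTree.Move (PlanarTree.node a (l₁ ++ t :: l₂)) (PlanarTree.node a (l₁ ++ t' :: l₂))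

/-- (Nonempty, non-planar) rooted trees decorated by `Ω`, up to isomorphism. -/
def RTree (Ω : Type*) : Type _ := Quot (PlanarTree.Move (Ω := Ω))

/-- Rooted forests decorated by `Ω`, up to isomorphism: finite multisets of nonempty trees.
The empty forest is `0` and the disjoint union of forests is `+`. -/
abbrev Forest (Ω : Type*) := Multiset (RTree Ω)

/-- Bottom-up evaluation of a planar tree. -/
def PlanarTree.fold {Ω β : Type*} (g : Ω → Multiset β → β) : PlanarTree Ω → β
  | .node a l => g a ((l.map (PlanarTree.fold g) : List β) : Multiset β)

theorem PlanarTree.fold_move {Ω β : Type*} (g : Ω → Multiset β → β) {t t' : PlanarTree Ω}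
    (h : PlanarTree.Move t t') : t.fold g = t'.fold g := by
  induction h with
  | perm a h =>
    rw [PlanarTree.fold, PlanarTree.fold, Multiset.coe_eq_coe.2 (h.map _)]
  | child a l₁ l₂ h ih =>
    rw [PlanarTree.fold, PlanarTree.fold]
    simp [ih]

namespace RTree

variable {Ω : Type*}

/-- The rooted tree represented by a planar tree. -/
def mk (t : PlanarTree Ω) : RTree Ω := Quot.mk _ t

theorem mk_eq_of_move {t t' : PlanarTree Ω} (h : PlanarTree.Move t t') : mk t = mk t' :=
  Quot.sound h

/-- A planar representative of a rooted tree. -/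
noncomputable def out (T : RTree Ω) : PlanarTree Ω := Quot.out T

@[simp] theorem mk_out (T : RTree Ω) : mk T.out = T := Quot.out_eq T

/-- The decoration of the root. -/
def root : RTree Ω → Ω :=
  Quot.lift (fun t => match t with | .node a _ => a) (by
    intro t t' h
    cases h <;> rfl)

/-- The forest obtained by deleting the root. -/
def children : RTree Ω → Forest Ω :=
  Quot.lift (fun t => match t with
    | .node _ l => ((l.map mk : List (RTree Ω)) : Forest Ω)) (by
    intro t t' h
    cases h with
    | perm a h => exact Multiset.coe_eq_coe.2 (h.map _)
    | child a l₁ l₂ h => simp [mk_eq_of_move h])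

/-- The tree obtained by grafting all trees of the forest `F` on a new root decorated by `a`. -/
noncomputable def node (a : Ω) (F : Forest Ω) : RTree Ω :=
  mk (.node a (F.toList.map out))

@[simp] theorem root_node (a : Ω) (F : Forest Ω) : (node a F).root = a := rfl

@[simp] theorem children_node (a : Ω) (F : Forest Ω) : (node a F).children = F := by
  change (((F.toList.map out).map mk : List (RTree Ω)) : Forest Ω) = F
  rw [List.map_map]
  have : (mk ∘ out : RTree Ω → RTree Ω) = id := funext mk_out
  rw [this, List.map_id, Multiset.coe_toList]

theorem mk_node_congr (a : Ω) {l l' : List (PlanarTree Ω)}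
    (h : List.Forall₂ (fun t t' => mk t = mk t') l l') (p : List (PlanarTree Ω)) :
    mk (.node a (p ++ l)) = mk (.node a (p ++ l')) := by
  induction h generalizing p with
  | nil => rfl
  | @cons t t' l l' ht _ ih =>
    have h1 : mk (.node a (p ++ t :: l)) = mk (.node a (p ++ t' :: l)) := by
      have := Quot.eqvGen_exact ht
      clear ht
      induction this with
      | rel x y h => exact mk_eq_of_move (.child a p l h)
      | refl x => rfl
      | symm x y _ ih => exact ih.symm
      | trans x y z _ _ ih1 ih2 => exact ih1.trans ih2
    have h2 := ih (p ++ [t'])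
    simp only [List.append_assoc, List.singleton_append] at h2
    exact h1.trans h2

@[simp] theorem node_root_children (T : RTree Ω) : node T.root T.children = T := by
  induction T using Quot.ind with
  | mk t =>
    obtain ⟨a, l⟩ := t
    change mk (.node a (((l.map mk : List (RTree Ω)) : Forest Ω).toList.map out)) =
      mk (.node a l)
    have hp : ((l.map mk : List (RTree Ω)) : Forest Ω).toList.Perm (l.map mk) :=
      Multiset.coe_eq_coe.1 (Multiset.coe_toList _)
    rw [mk_eq_of_move (PlanarTree.Move.perm a (hp.map out))]
    refine mk_node_congr a ?_ []
    rw [List.map_map, List.forall₂_map_left_iff]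
    exact List.forall₂_same.2 fun t _ => mk_out _

/-- Bottom-up evaluation of a rooted tree: `fold g (node a F) = g a (F.map (fold g))`. -/
def fold {β : Type*} (g : Ω → Multiset β → β) : RTree Ω → β :=
  Quot.lift (PlanarTree.fold g) fun _ _ h => PlanarTree.fold_move g h

theorem fold_eq {β : Type*} (g : Ω → Multiset β → β) (T : RTree Ω) :
    T.fold g = g T.root (T.children.map (fold g)) := by
  induction T using Quot.ind with
  | mk t =>
    obtain ⟨a, l⟩ := t
    change PlanarTree.fold g (.node a l) =
      g a (((l.map mk : List (RTree Ω)) : Forest Ω).map (fold g))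
    rw [PlanarTree.fold, Multiset.map_coe, List.map_map]
    rfl

theorem fold_node {β : Type*} (g : Ω → Multiset β → β) (a : Ω) (F : Forest Ω) :
    (node a F).fold g = g a (F.map (fold g)) := by
  rw [fold_eq, root_node, children_node]

/-- The number of vertices of a tree. -/
def size : RTree Ω → ℕ := fold fun _ s => 1 + s.sum

/-- `S` is one of the subtrees of `T` made of a vertex of `T` and of everything above it. These
subtrees correspond to the vertices of `T`: the decoration of the vertex is `S.root`, its direct
successors are the roots of the trees in `S.children`. -/
inductive IsVertexSubtree (S : RTree Ω) : RTree Ω → Prop where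
  | refl : IsVertexSubtree S S
  | child {T T' : RTree Ω} : T' ∈ T.children → IsVertexSubtree S T' → IsVertexSubtree S T

end RTree

/-- The number of vertices of a forest. -/
def Forest.size {Ω : Type*} (F : Forest Ω) : ℕ := (F.map RTree.size).sum

theorem RTree.size_eq {Ω : Type*} (T : RTree Ω) : T.size = 1 + Forest.size T.children :=
  RTree.fold_eq _ T

theorem Forest.size_singleton {Ω : Type*} (T : RTree Ω) : Forest.size {T} = T.size := by
  simp [Forest.size]

theorem Forest.size_le_of_mem {Ω : Type*} {F : Forest Ω} {T : RTree Ω} (h : T ∈ F) :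
    T.size ≤ Forest.size F :=
  Multiset.le_sum_of_mem (Multiset.mem_map_of_mem _ h)

/-! ### The algebra of forests -/

/-- The commutative real algebra freely generated by `Ω`-decorated rooted trees: the linear span
of forests with the concatenation (disjoint union) product. -/
abbrev ForestAlg (Ω : Type*) := AddMonoidAlgebra ℝ (Forest Ω)

/-- A forest, as an element of the algebra of forests. -/
noncomputable def ofForest {Ω : Type*} (F : Forest Ω) : ForestAlg Ω := AddMonoidAlgebra.single F 1

/-- The grafting operator `B₊ᵃ`, extended linearly. -/
noncomputable def graft {Ω : Type*} (a : Ω) : ForestAlg Ω →ₗ[ℝ] ForestAlg Ω :=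
  AddMonoidAlgebra.mapDomainLinearMap ℝ ℝ fun F : Forest Ω => ({RTree.node a F} : Forest Ω)

theorem graft_ofForest {Ω : Type*} (a : Ω) (F : Forest Ω) :
    graft a (ofForest F) = ofForest {RTree.node a F} := by
  simp [graft, ofForest]

/-- The algebra morphism from forests to a commutative algebra `A` with operations `β a : A → A`,
determined by `∅ ↦ 1`, `F₁F₂ ↦ Φ(F₁)Φ(F₂)` and `B₊ᵃ(F) ↦ β a (Φ(F))` for all forests. -/
noncomputable def operatedLift {Ω A : Type*} [CommRing A] [Algebra ℝ A] (β : Ω → A → A) :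
    ForestAlg Ω →ₐ[ℝ] A :=
  AddMonoidAlgebra.lift ℝ A (Forest Ω)
    { toFun := fun F => (F.toAdd.map (RTree.fold fun a s => β a s.prod)).prod
      map_one' := by simp
      map_mul' := by intro F G; simp }

theorem operatedLift_ofForest {Ω A : Type*} [CommRing A] [Algebra ℝ A] (β : Ω → A → A)
    (F : Forest Ω) : operatedLift β (ofForest F)
      = (F.map (RTree.fold fun a s => β a s.prod)).prod := by
  simp only [operatedLift, ofForest, AddMonoidAlgebra.lift_single, one_smul]
  rfl

theorem operatedLift_graft {Ω A : Type*} [CommRing A] [Algebra ℝ A] (β : Ω → A → A)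
    (a : Ω) (F : Forest Ω) :
    operatedLift β (graft a (ofForest F)) = β a (operatedLift β (ofForest F)) := by
  rw [graft_ofForest, operatedLift_ofForest, operatedLift_ofForest, Multiset.map_singleton,
    Multiset.prod_singleton, RTree.fold_node]

/-- The branching `φ̂` of `φ : A → A`: `φ̂(B₊ᵃ(F)) = φ(a φ̂(F))`. -/
noncomputable def branching {A : Type*} [CommRing A] [Algebra ℝ A] (φ : A → A) :
    ForestAlg A →ₐ[ℝ] A :=
  operatedLift fun a u => φ (a * u)

/-- The lifting `φ♯` of `φ : Ω₁ → Ω₂`, which applies `φ` to all decorations. -/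
noncomputable def lifting {Ω₁ Ω₂ : Type*} (φ : Ω₁ → Ω₂) : ForestAlg Ω₁ →ₐ[ℝ] ForestAlg Ω₂ :=
  operatedLift fun a u => graft (φ a) u

/-! ### Shuffle products of forests -/

open Classical in
/-- The `λ`-shuffle of two forests, for a product `op` on `Ω`. The expression in brackets is the
`λ`-shuffle of the two trees `T` and `t`. -/
noncomputable def shuffleForest {Ω : Type*} (op : Ω → Ω → Ω) (lam : ℝ) (F G : Forest Ω) :
    ForestAlg Ω :=
  if F = 0 then ofForest G
  else if G = 0 then ofForest F
  else ((F.card : ℝ) * (G.card : ℝ))⁻¹ •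
    (F.attach.map fun T => (G.attach.map fun t =>
      (graft T.1.root (shuffleForest op lam T.1.children {t.1})
        + graft t.1.root (shuffleForest op lam {T.1} t.1.children)
        + lam • graft (op T.1.root t.1.root) (shuffleForest op lam T.1.children t.1.children))
      * ofForest (F.erase T.1 + G.erase t.1)).sum).sum
termination_by Forest.size F + Forest.size G
decreasing_by
  all_goals
    have h1 := Forest.size_le_of_mem T.2
    have h2 := Forest.size_le_of_mem t.2
    have h3 := RTree.size_eq T.1
    have h4 := RTree.size_eq t.1
    have h5 := Forest.size_singleton T.1
    have h6 := Forest.size_singleton t.1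
    omega

theorem shuffleForest_zero_left {Ω : Type*} (op : Ω → Ω → Ω) (lam : ℝ) (G : Forest Ω) :
    shuffleForest op lam 0 G = ofForest G := by
  rw [shuffleForest, if_pos rfl]

theorem shuffleForest_zero_right {Ω : Type*} (op : Ω → Ω → Ω) (lam : ℝ) (F : Forest Ω) :
    shuffleForest op lam F 0 = ofForest F := by
  rw [shuffleForest]
  split_ifs with h h'
  · rw [h]
  · rfl
  · exact absurd rfl h'

/-- Compatibility with the grafting. -/
theorem shuffleForest_tree {Ω : Type*} (op : Ω → Ω → Ω) (lam : ℝ) (T t : RTree Ω) :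
    shuffleForest op lam {T} {t} =
      graft T.root (shuffleForest op lam T.children {t})
        + graft t.root (shuffleForest op lam {T} t.children)
        + lam • graft (op T.root t.root) (shuffleForest op lam T.children t.children) := by
  classical
  rw [shuffleForest, if_neg (Multiset.singleton_ne_zero _), if_neg (Multiset.singleton_ne_zero _),
    Multiset.attach_map_val' {T} (fun T' => (Multiset.map (fun t' : {x // x ∈ ({t} : Forest Ω)} =>
      (graft T'.root (shuffleForest op lam T'.children {t'.1})
        + graft t'.1.root (shuffleForest op lam {T'} t'.1.children)
        + lam • graft (op T'.root t'.1.root) (shuffleForest op lam T'.children t'.1.children))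
      * ofForest (Multiset.erase {T} T' + Multiset.erase {t} t'.1))
        (Multiset.attach {t})).sum), Multiset.map_singleton, Multiset.sum_singleton,
    Multiset.attach_map_val' {t} (fun t' =>
      (graft T.root (shuffleForest op lam T.children {t'})
        + graft t'.root (shuffleForest op lam {T} t'.children)
        + lam • graft (op T.root t'.root) (shuffleForest op lam T.children t'.children))
      * ofForest (Multiset.erase {T} T + Multiset.erase {t} t')),
    Multiset.map_singleton, Multiset.sum_singleton]
  have h1 : ofForest (0 : Forest Ω) = 1 := rfl
  simp [h1]

open Classical in
/-- Compatibility with the concatenation. -/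
theorem shuffleForest_concat {Ω : Type*} (op : Ω → Ω → Ω) (lam : ℝ) {F G : Forest Ω}
    (hF : F ≠ 0) (hG : G ≠ 0) :
    shuffleForest op lam F G = ((F.card : ℝ) * (G.card : ℝ))⁻¹ •
      (F.map fun T => (G.map fun t =>
        shuffleForest op lam {T} {t} * ofForest (F.erase T + G.erase t)).sum).sum := by
  rw [shuffleForest, if_neg hF, if_neg hG]
  simp only [← shuffleForest_tree]
  congr 2
  rw [← Multiset.attach_map_val' F]
  refine Multiset.map_congr rfl fun T _ => ?_
  rw [← Multiset.attach_map_val' G]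

/-- The `λ`-shuffle product of forests, extended bilinearly. -/
noncomputable def lambdaShuffle {Ω : Type*} (op : Ω → Ω → Ω) (lam : ℝ) :
    ForestAlg Ω →ₗ[ℝ] ForestAlg Ω →ₗ[ℝ] ForestAlg Ω :=
  (AddMonoidAlgebra.basis (Forest Ω) ℝ).constr ℝ fun F =>
    (AddMonoidAlgebra.basis (Forest Ω) ℝ).constr ℝ fun G => shuffleForest op lam F G

theorem lambdaShuffle_ofForest {Ω : Type*} (op : Ω → Ω → Ω) (lam : ℝ) (F G : Forest Ω) :
    lambdaShuffle op lam (ofForest F) (ofForest G) = shuffleForest op lam F G := by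
  have h (F : Forest Ω) : ofForest F = AddMonoidAlgebra.basis (Forest Ω) ℝ F := rfl
  rw [h, h, lambdaShuffle, Module.Basis.constr_basis, Module.Basis.constr_basis]

/-- The shuffle product on trees, for a decoration set without product. It is the `λ`-shuffle
for `λ = 0`; the choice of the product on `Ω` plays no role. -/
noncomputable def treeShuffle {Ω : Type*} : ForestAlg Ω →ₗ[ℝ] ForestAlg Ω →ₗ[ℝ] ForestAlg Ω :=
  lambdaShuffle (fun a _ => a) 0

theorem treeShuffle_tree {Ω : Type*} (T t : RTree Ω) :
    treeShuffle (ofForest {T}) (ofForest {t}) =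
      graft T.root (treeShuffle (ofForest T.children) (ofForest {t}))
        + graft t.root (treeShuffle (ofForest {T}) (ofForest t.children)) := by
  simp only [treeShuffle, lambdaShuffle_ofForest]
  rw [shuffleForest_tree, zero_smul, add_zero]

/-- The stuffle product on forests decorated by the additive semigroup of positive integers. -/
noncomputable def treeStuffle : ForestAlg ℕ+ →ₗ[ℝ] ForestAlg ℕ+ →ₗ[ℝ] ForestAlg ℕ+ :=
  lambdaShuffle (fun a b => a + b) 1

/-- The anti-stuffle product on forests decorated by the additive semigroup of positive
integers. -/
noncomputable def treeAntiStuffle : ForestAlg ℕ+ →ₗ[ℝ] ForestAlg ℕ+ →ₗ[ℝ] ForestAlg ℕ+ :=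
  lambdaShuffle (fun a b => a + b) (-1)

/-- `ζ` restricts to an algebra morphism from `C`, with the (possibly non-associative) product
`mul` and the unit `∅`, to the real numbers. -/
structure IsAlgMorphismOn {Ω : Type*} (C : Submodule ℝ (ForestAlg Ω))
    (mul : ForestAlg Ω →ₗ[ℝ] ForestAlg Ω →ₗ[ℝ] ForestAlg Ω) (ζ : ForestAlg Ω → ℝ) : Prop where
  unit_mem : ofForest 0 ∈ C
  mul_mem : ∀ x ∈ C, ∀ y ∈ C, mul x y ∈ C
  map_unit : ζ (ofForest 0) = 1
  map_add : ∀ x ∈ C, ∀ y ∈ C, ζ (x + y) = ζ x + ζ y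
  map_smul : ∀ (c : ℝ), ∀ x ∈ C, ζ (c • x) = c * ζ x
  map_mul : ∀ x ∈ C, ∀ y ∈ C, ζ (mul x y) = ζ x * ζ y

/-! ### Stuffle arborified zeta values -/

/-- The span of convergent forests: all roots are decorated by integers `≥ 2`. -/
noncomputable def convStuffle : Submodule ℝ (ForestAlg ℕ+) :=
  Submodule.span ℝ {x | ∃ F : Forest ℕ+, (∀ T ∈ F, 2 ≤ T.root) ∧ x = ofForest F}

/-- The decoration `α` becomes the sequence `n ↦ n ^ (-α)`. -/
noncomputable def powSeq (α : ℕ+) : ℕ → ℝ := fun n => ((n : ℝ) ^ (α : ℕ))⁻¹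

/-- The summation operator `u ↦ (N ↦ ∑_{1 ≤ n ≤ N} u n)`. -/
noncomputable def sumOp (u : ℕ → ℝ) : ℕ → ℝ := fun N => ∑ n ∈ Finset.Icc 1 N, u n

/-- The summation operator translated by `-1`, `u ↦ (N ↦ ∑_{1 ≤ n ≤ N - 1} u n)`. -/
noncomputable def shiftedSumOp (u : ℕ → ℝ) : ℕ → ℝ := fun N => ∑ n ∈ Finset.Ico 1 N, u n

/-- The truncated arborified zeta value with strict inequalities. -/
noncomputable def partialStuffle (x : ForestAlg ℕ+) : ℕ → ℝ :=
  branching shiftedSumOp (lifting powSeq x)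

/-- The truncated arborified zeta value with large inequalities. -/
noncomputable def partialStuffleStar (x : ForestAlg ℕ+) : ℕ → ℝ :=
  branching sumOp (lifting powSeq x)

/-- The stuffle arborified zeta values. -/
noncomputable def zetaStuffle (x : ForestAlg ℕ+) : ℝ := limUnder atTop (partialStuffle x)

/-- The star version of the stuffle arborified zeta values. -/
noncomputable def zetaStuffleStar (x : ForestAlg ℕ+) : ℝ := limUnder atTop (partialStuffleStar x)

/-! ### Shuffle arborified zeta values -/

/-- The alphabet `{x, y}`. -/
inductive XY where
  | x
  | y

/-- A forest decorated by `{x, y}` is semiconvergent if all its leaves (no direct successor) and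
all its branching vertices (at least two direct successors) are decorated by `y`. -/
def IsSemiconvergent (F : Forest XY) : Prop :=
  ∀ T ∈ F, ∀ S : RTree XY, RTree.IsVertexSubtree S T →
    (S.children.card = 0 ∨ 2 ≤ S.children.card) → S.root = XY.y

/-- The span of convergent forests: semiconvergent, with all roots decorated by `x`. -/
noncomputable def convShuffle : Submodule ℝ (ForestAlg XY) :=
  Submodule.span ℝ {v | ∃ F : Forest XY,
    IsSemiconvergent F ∧ (∀ T ∈ F, T.root = XY.x) ∧ v = ofForest F}

/-- The functions `σ_x(t) = 1 / t` and `σ_y(t) = 1 / (1 - t)`. -/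
noncomputable def sigmaXY : XY → ℝ → ℝ
  | .x => fun t => 1 / t
  | .y => fun t => 1 / (1 - t)

/-- The integration operator `f ↦ (z ↦ ∫_ε^z f(t) dt)`. -/
noncomputable def intOp (ε : ℝ) (f : ℝ → ℝ) : ℝ → ℝ := fun z => ∫ t in ε..z, f t

/-- The arborified iterated integral on `[ε, z]`, used for `0 < ε < z < 1`. All integrands that
occur are then continuous on `[ε, z]`. -/
noncomputable def chenInt (ε : ℝ) (v : ForestAlg XY) : ℝ → ℝ :=
  branching (intOp ε) (lifting sigmaXY v)

/-- Arborified polylogarithms, used for `0 < z < 1`. -/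
noncomputable def polylog (v : ForestAlg XY) (z : ℝ) : ℝ :=
  limUnder (𝓝[>] 0) fun ε => chenInt ε v z

/-- The shuffle arborified zeta values. -/
noncomputable def zetaShuffle (v : ForestAlg XY) : ℝ := limUnder (𝓝[<] 1) (polylog v)

end ArboZeta

namespace ArboZeta

/-! ### Induction principles and elements of the algebra of forests -/

/-! Before any limit is taken, each zeta value is given by an algebra morphism `Φ` for concatenation
with `Φ(B₊ᵃ(F)) = P(σ_a Φ(F))`, where `P` is a Rota–Baxter operator of weight `λ`: `P(u)P(v) = P(u
P(v)) + P(P(u) v) + λ P(uv)`. Strict sums have weight `1`, large sums weight `-1`, and integration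
weight `0`. The recursion for the shuffle of two trees copies this identity, and the averaged
formula for forests is harmless because all its summands have the same image. So `Φ` is
multiplicative for the tree product already at the truncated level (`map_shuffleForest`), and this
passes to the limit (`isAlgMorphismOn_of_tendsto`).

The limits exist by monotonicity and boundedness. For sums, a forest with `m` vertices is at most
`H_N ^ m` with `H_N` the harmonic number (`truncZeta_le`), so a tree whose root is at least `2` is
bounded by the convergent series `∑ H_n ^ k / n²`. For integrals, put `L(z) = 1 - log (1 - z)`; a
semiconvergent tree `T` is at most `z L(z) ^ |T|` (`chenInt_tree_le`). The factor `z` cancels the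
singularity `1/t` of the next vertex `x`, and at a root `x` there remains a power of the logarithm,
integrable at `1`.

Stability of the convergent forests is read off the roots in the stuffle cases. In the shuffle case
the point is that the product of two trees is a combination of single trees, so a vertex `x` keeps
exactly one successor (`treeShuffle_mem_forestSpan`). -/

theorem RTree.induction {Ω : Type*} {P : RTree Ω → Prop}
    (h : ∀ T : RTree Ω, (∀ T' ∈ T.children, P T') → P T) (T : RTree Ω) : P T := by
  induction hn : T.size using Nat.strong_induction_on generalizing T with
  | _ n ih =>
    refine h T fun T' hT' => ih T'.size ?_ T' rfl
    have h1 := Forest.size_le_of_mem hT'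
    have h2 := RTree.size_eq T
    omega

theorem ofForest_zero {Ω : Type*} : ofForest (0 : Forest Ω) = 1 := rfl

theorem ofForest_add {Ω : Type*} (F G : Forest Ω) :
    ofForest (F + G) = ofForest F * ofForest G := by
  simp [ofForest, AddMonoidAlgebra.single_mul_single]

theorem ofForest_cons {Ω : Type*} (T : RTree Ω) (F : Forest Ω) :
    ofForest (T ::ₘ F) = ofForest {T} * ofForest F := by
  rw [← ofForest_add, Multiset.singleton_add]

theorem ofForest_singleton {Ω : Type*} (T : RTree Ω) :
    ofForest {T} = graft T.root (ofForest T.children) := by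
  rw [graft_ofForest, RTree.node_root_children]

theorem ForestAlg.induction {Ω : Type*} {P : ForestAlg Ω → Prop} (x : ForestAlg Ω)
    (forest : ∀ F, P (ofForest F)) (add : ∀ x y, P x → P y → P (x + y))
    (smul : ∀ (c : ℝ) x, P x → P (c • x)) : P x := by
  have hx : x ∈ Submodule.span ℝ (Set.range (AddMonoidAlgebra.basis (Forest Ω) ℝ)) := by
    rw [Module.Basis.span_eq]; trivial
  induction hx using Submodule.span_induction with
  | mem x h => obtain ⟨F, rfl⟩ := h; exact forest F
  | zero => simpa using smul 0 _ (forest 0)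
  | add x y _ _ hx hy => exact add x y hx hy
  | smul c x _ hx => exact smul c x hx

/-- `operatedLift_graft` applies to forests only, since its operators need not be linear; to use it
after a lifting, the lifted element must be known to be a forest. -/
theorem exists_lifting_ofForest {Ω₁ Ω₂ : Type*} (φ : Ω₁ → Ω₂) (F : Forest Ω₁) :
    ∃ F', lifting φ (ofForest F) = ofForest F' := by
  -- Passage from trees to forests, used both for `F` and for the children in the induction on
  -- trees.
  have key (F : Forest Ω₁) (h : ∀ T ∈ F, ∃ T', lifting φ (ofForest {T}) = ofForest {T'}) :
      ∃ F', lifting φ (ofForest F) = ofForest F' := by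
    induction F using Multiset.induction with
    | empty => exact ⟨0, by rw [ofForest_zero, ofForest_zero, map_one]⟩
    | cons T F ih =>
      obtain ⟨T', hT'⟩ := h T (Multiset.mem_cons_self T F)
      obtain ⟨F', hF'⟩ := ih fun T hT => h T (Multiset.mem_cons_of_mem hT)
      exact ⟨T' ::ₘ F', by rw [ofForest_cons, ofForest_cons, map_mul, hT', hF']⟩
  refine key F fun T hT => ?_
  clear hT
  induction T using RTree.induction with
  | h T ih =>
    obtain ⟨F', hF'⟩ := key T.children ih
    refine ⟨RTree.node (φ T.root) F', ?_⟩
    rw [← graft_ofForest, ofForest_singleton, ← hF', lifting, operatedLift_graft]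

theorem branching_lifting_graft {Ω A : Type*} [CommRing A] [Algebra ℝ A] (φ : A → A) (p : Ω → A)
    (a : Ω) (F : Forest Ω) :
    branching φ (lifting p (graft a (ofForest F)))
      = φ (p a * branching φ (lifting p (ofForest F))) := by
  have h : lifting p (graft a (ofForest F)) = graft (p a) (lifting p (ofForest F)) :=
    operatedLift_graft _ a F
  obtain ⟨F', hF'⟩ := exists_lifting_ofForest p F
  rw [h, hF', branching, operatedLift_graft]

/-! ### Morphisms for the shuffle products -/

/-- `H` is the Rota–Baxter identity, with `u`, `v`, `w` in the role of the three smaller shuffles,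
known only through their images. In this form it does not require grafting to correspond to an
operator on all of `A`. -/
theorem map_shuffleForest {Ω A : Type*} [CommRing A] [Algebra ℝ A] (op : Ω → Ω → Ω) (lam : ℝ)
    (Φ : ForestAlg Ω →ₐ[ℝ] A)
    (H : ∀ a b x y u v w, Φ u = Φ x * Φ (graft b y) → Φ v = Φ (graft a x) * Φ y →
      Φ w = Φ x * Φ y →
      Φ (graft a u) + Φ (graft b v) + lam • Φ (graft (op a b) w) = Φ (graft a x) * Φ (graft b y))
    (F G : Forest Ω) :
    Φ (shuffleForest op lam F G) = Φ (ofForest F) * Φ (ofForest G) := by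
  classical
  induction hn : Forest.size F + Forest.size G using Nat.strong_induction_on
    generalizing F G with
  | _ n ih =>
    rcases eq_or_ne F 0 with rfl | hF
    · rw [shuffleForest_zero_left, ofForest_zero, map_one, one_mul]
    rcases eq_or_ne G 0 with rfl | hG
    · rw [shuffleForest_zero_right, ofForest_zero, map_one, mul_one]
    have tree : ∀ T ∈ F, ∀ t ∈ G,
        Φ (shuffleForest op lam {T} {t}) = Φ (ofForest {T}) * Φ (ofForest {t}) := by
      intro T hT t ht
      have h1 := Forest.size_le_of_mem hT
      have h2 := Forest.size_le_of_mem ht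
      have h3 := RTree.size_eq T
      have h4 := RTree.size_eq t
      have h5 := Forest.size_singleton T
      have h6 := Forest.size_singleton t
      rw [shuffleForest_tree, map_add, map_add, map_smul, ofForest_singleton T,
        ofForest_singleton t]
      refine H _ _ _ _ _ _ _ ?_ ?_ ?_
      · rw [← ofForest_singleton]
        exact ih _ (by omega) _ _ rfl
      · rw [← ofForest_singleton]
        exact ih _ (by omega) _ _ rfl
      · exact ih _ (by omega) _ _ rfl
    -- Multiplicativity puts `T` and `t` back into the remaining forests, so the sum consists of
    -- `F.card * G.card` equal terms and the normalisation cancels their number.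
    have summand : ∀ T ∈ F, ∀ t ∈ G,
        Φ (shuffleForest op lam {T} {t} * ofForest (F.erase T + G.erase t))
          = Φ (ofForest F) * Φ (ofForest G) := by
      intro T hT t ht
      rw [map_mul, tree T hT t ht, ofForest_add, map_mul, mul_mul_mul_comm, ← map_mul, ← map_mul,
        ← ofForest_cons, ← ofForest_cons, Multiset.cons_erase hT, Multiset.cons_erase ht]
    have hc : (F.card : ℝ) * (G.card : ℝ) ≠ 0 := by
      simp [hF, hG]
    rw [shuffleForest_concat op lam hF hG, map_smul, map_multiset_sum, Multiset.map_map]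
    rw [Multiset.map_congr rfl (g := fun _ => G.card • (Φ (ofForest F) * Φ (ofForest G))) (by
      intro T hT
      rw [Function.comp_apply, map_multiset_sum, Multiset.map_map, Function.comp_def,
        Multiset.map_congr rfl (g := fun _ => Φ (ofForest F) * Φ (ofForest G))
          (fun t ht => summand T hT t ht), Multiset.map_const', Multiset.sum_replicate])]
    rw [Multiset.map_const', Multiset.sum_replicate, ← mul_nsmul, ← Nat.cast_smul_eq_nsmul ℝ,
      smul_smul, Nat.cast_mul, mul_comm (G.card : ℝ), inv_mul_cancel₀ hc, one_smul]

theorem map_lambdaShuffle {Ω A : Type*} [CommRing A] [Algebra ℝ A] (op : Ω → Ω → Ω) (lam : ℝ)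
    (Φ : ForestAlg Ω →ₐ[ℝ] A)
    (H : ∀ a b x y u v w, Φ u = Φ x * Φ (graft b y) → Φ v = Φ (graft a x) * Φ y →
      Φ w = Φ x * Φ y →
      Φ (graft a u) + Φ (graft b v) + lam • Φ (graft (op a b) w) = Φ (graft a x) * Φ (graft b y))
    (x y : ForestAlg Ω) : Φ (lambdaShuffle op lam x y) = Φ x * Φ y := by
  induction x using ForestAlg.induction with
  | forest F =>
    induction y using ForestAlg.induction with
    | forest G => rw [lambdaShuffle_ofForest, map_shuffleForest op lam Φ H]
    | add y y' h h' => rw [map_add, map_add, h, h', map_add, mul_add]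
    | smul c y h => rw [map_smul, map_smul, h, map_smul, mul_smul_comm]
  | add x x' h h' => rw [map_add, LinearMap.add_apply, map_add, h, h', map_add, add_mul]
  | smul c x h => rw [map_smul, LinearMap.smul_apply, map_smul, h, map_smul, smul_mul_assoc]

/-! ### Spans of forests -/

/-- The span of the forests that satisfy `P`. -/
noncomputable def forestSpan {Ω : Type*} (P : Forest Ω → Prop) : Submodule ℝ (ForestAlg Ω) :=
  Submodule.span ℝ {x | ∃ F : Forest Ω, P F ∧ x = ofForest F}

section ForestSpan

variable {Ω : Type*} {P Q R : Forest Ω → Prop}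

theorem ofForest_mem_forestSpan {F : Forest Ω} (h : P F) : ofForest F ∈ forestSpan P :=
  Submodule.subset_span ⟨F, h, rfl⟩

theorem forestSpan_induction {p : ForestAlg Ω → Prop} {x : ForestAlg Ω} (hx : x ∈ forestSpan P)
    (forest : ∀ F, P F → p (ofForest F)) (zero : p 0) (add : ∀ x y, p x → p y → p (x + y))
    (smul : ∀ (c : ℝ) x, p x → p (c • x)) : p x := by
  induction hx using Submodule.span_induction with
  | mem x h => obtain ⟨F, hF, rfl⟩ := h; exact forest F hF
  | zero => exact zero
  | add x y _ _ hx hy => exact add x y hx hy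
  | smul c x _ hx => exact smul c x hx

theorem forestSpan_top (x : ForestAlg Ω) : x ∈ forestSpan fun _ : Forest Ω => True := by
  induction x using ForestAlg.induction with
  | forest F => exact ofForest_mem_forestSpan trivial
  | add x y hx hy => exact add_mem hx hy
  | smul c x hx => exact Submodule.smul_mem _ c hx

theorem bilin_mem_forestSpan (B : ForestAlg Ω →ₗ[ℝ] ForestAlg Ω →ₗ[ℝ] ForestAlg Ω)
    (h : ∀ F G, P F → Q G → B (ofForest F) (ofForest G) ∈ forestSpan R) {x y : ForestAlg Ω}
    (hx : x ∈ forestSpan P) (hy : y ∈ forestSpan Q) : B x y ∈ forestSpan R := by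
  refine forestSpan_induction (p := fun x => B x y ∈ forestSpan R) hx (fun F hF => ?_) (by simp)
    (fun x x' hx hx' => ?_) (fun c x hx => ?_)
  · refine forestSpan_induction (p := fun y => B (ofForest F) y ∈ forestSpan R) hy
      (fun G hG => h F G hF hG) (by simp) (fun y y' hy hy' => ?_)
      (fun c y hy => ?_)
    · rw [map_add]; exact add_mem hy hy'
    · rw [map_smul]; exact Submodule.smul_mem _ _ hy
  · rw [map_add, LinearMap.add_apply]; exact add_mem hx hx'
  · rw [map_smul, LinearMap.smul_apply]; exact Submodule.smul_mem _ _ hx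

theorem graft_mem_forestSpan (a : Ω) (h : ∀ F, P F → Q {RTree.node a F}) {x : ForestAlg Ω}
    (hx : x ∈ forestSpan P) : graft a x ∈ forestSpan Q := by
  refine forestSpan_induction (p := fun x => graft a x ∈ forestSpan Q) hx (fun F hF => ?_)
    (by simp) (fun x y hx hy => ?_) (fun c x hx => ?_)
  · rw [graft_ofForest]; exact ofForest_mem_forestSpan (h F hF)
  · rw [map_add]; exact add_mem hx hy
  · rw [map_smul]; exact Submodule.smul_mem _ _ hx

theorem mul_mem_forestSpan (h : ∀ F G, P F → Q G → R (F + G)) {x y : ForestAlg Ω}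
    (hx : x ∈ forestSpan P) (hy : y ∈ forestSpan Q) : x * y ∈ forestSpan R :=
  bilin_mem_forestSpan (LinearMap.mul ℝ (ForestAlg Ω)) (fun F G hF hG => by
    rw [LinearMap.mul_apply', ← ofForest_add]
    exact ofForest_mem_forestSpan (h F G hF hG)) hx hy

theorem lambdaShuffle_mem_forestSpan (op : Ω → Ω → Ω) (lam : ℝ)
    (h : ∀ F G, P F → Q G → shuffleForest op lam F G ∈ forestSpan R) {x y : ForestAlg Ω}
    (hx : x ∈ forestSpan P) (hy : y ∈ forestSpan Q) : lambdaShuffle op lam x y ∈ forestSpan R :=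
  bilin_mem_forestSpan _ (fun F G hF hG => by
    rw [lambdaShuffle_ofForest]
    exact h F G hF hG) hx hy

end ForestSpan

/-- A condition imposed on every tree of a forest is stable under the shuffle of two forests as
soon as it is stable under the shuffle of the trees that occur. -/
theorem shuffleForest_mem_forestSpan {Ω : Type*} {P : RTree Ω → Prop} (op : Ω → Ω → Ω) (lam : ℝ)
    {F G : Forest Ω} (hF : ∀ T ∈ F, P T) (hG : ∀ t ∈ G, P t)
    (h : ∀ T ∈ F, ∀ t ∈ G,
      shuffleForest op lam {T} {t} ∈ forestSpan fun F => ∀ T ∈ F, P T) :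
    shuffleForest op lam F G ∈ forestSpan fun F => ∀ T ∈ F, P T := by
  classical
  rcases eq_or_ne F 0 with rfl | hF0
  · rw [shuffleForest_zero_left]
    exact ofForest_mem_forestSpan hG
  rcases eq_or_ne G 0 with rfl | hG0
  · rw [shuffleForest_zero_right]
    exact ofForest_mem_forestSpan hF
  rw [shuffleForest_concat op lam hF0 hG0]
  refine Submodule.smul_mem _ _ (multiset_sum_mem _ fun x hx => ?_)
  obtain ⟨T, hT, rfl⟩ := Multiset.mem_map.1 hx
  refine multiset_sum_mem _ fun x hx => ?_
  obtain ⟨t, ht, rfl⟩ := Multiset.mem_map.1 hx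
  refine mul_mem_forestSpan (Q := fun F => ∀ T ∈ F, P T) (fun F G hF hG S hS => ?_) (h T hT t ht)
    (ofForest_mem_forestSpan fun S hS => ?_)
  · rcases Multiset.mem_add.1 hS with hS | hS
    exacts [hF S hS, hG S hS]
  · rcases Multiset.mem_add.1 hS with hS | hS
    exacts [hF S (Multiset.mem_of_mem_erase hS), hG S (Multiset.mem_of_mem_erase hS)]

/-! ### Algebra morphisms obtained as limits -/

/-- Uniqueness of limits. The identities are required only eventually because those for integrals
need the parameter close to the endpoint. -/
theorem isAlgMorphismOn_of_tendsto {Ω ι : Type*} {C : Submodule ℝ (ForestAlg Ω)}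
    {mul : ForestAlg Ω →ₗ[ℝ] ForestAlg Ω →ₗ[ℝ] ForestAlg Ω} {ζ : ForestAlg Ω → ℝ}
    {l : Filter ι} [l.NeBot] {Z : ForestAlg Ω → ι → ℝ}
    (unit_mem : ofForest 0 ∈ C) (mul_mem : ∀ x ∈ C, ∀ y ∈ C, mul x y ∈ C)
    (lim : ∀ x ∈ C, Tendsto (Z x) l (𝓝 (ζ x)))
    (map_unit : ∀ᶠ i in l, Z (ofForest 0) i = 1)
    (map_add : ∀ᶠ i in l, ∀ x ∈ C, ∀ y ∈ C, Z (x + y) i = Z x i + Z y i)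
    (map_smul : ∀ᶠ i in l, ∀ (c : ℝ), ∀ x ∈ C, Z (c • x) i = c * Z x i)
    (map_mul : ∀ᶠ i in l, ∀ x ∈ C, ∀ y ∈ C, Z (mul x y) i = Z x i * Z y i) :
    IsAlgMorphismOn C mul ζ where
  unit_mem := unit_mem
  mul_mem := mul_mem
  map_unit := tendsto_nhds_unique (lim _ unit_mem)
    (tendsto_const_nhds.congr' (map_unit.mono fun _ h => h.symm))
  map_add x hx y hy := tendsto_nhds_unique (lim _ (C.add_mem hx hy))
    (((lim x hx).add (lim y hy)).congr' (map_add.mono fun _ h => (h x hx y hy).symm))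
  map_smul c x hx := tendsto_nhds_unique (lim _ (C.smul_mem c hx))
    (((lim x hx).const_mul c).congr' (map_smul.mono fun _ h => (h c x hx).symm))
  map_mul x hx y hy := tendsto_nhds_unique (lim _ (mul_mem x hx y hy))
    (((lim x hx).mul (lim y hy)).congr' (map_mul.mono fun _ h => (h x hx y hy).symm))

/-! ### Stuffle arborified zeta values -/

theorem convStuffle_eq : convStuffle = forestSpan fun F => ∀ T ∈ F, 2 ≤ T.root := rfl

theorem lambdaShuffle_mem_convStuffle (lam : ℝ) {x y : ForestAlg ℕ+} (hx : x ∈ convStuffle)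
    (hy : y ∈ convStuffle) : lambdaShuffle (fun a b => a + b) lam x y ∈ convStuffle := by
  rw [convStuffle_eq] at *
  refine lambdaShuffle_mem_forestSpan _ _ (fun F G hF hG => ?_) hx hy
  refine shuffleForest_mem_forestSpan _ _ hF hG fun T hT t ht => ?_
  -- Only the root matters, so nothing has to be known about `z`.
  have graft_mem (a : ℕ+) (ha : 2 ≤ a) (z : ForestAlg ℕ+) :
      graft a z ∈ forestSpan fun F : Forest ℕ+ => ∀ T ∈ F, 2 ≤ T.root :=
    graft_mem_forestSpan a (fun F _ S hS => by
      rw [Multiset.mem_singleton.1 hS, RTree.root_node]; exact ha) (forestSpan_top z)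
  rw [shuffleForest_tree]
  exact add_mem (add_mem (graft_mem _ (hF T hT) _) (graft_mem _ (hG t ht) _))
    (Submodule.smul_mem _ _ (graft_mem _ ((hF T hT).trans (PNat.lt_add_right _ _).le) _))

/-- The summation operator over the finite sets `S N`. -/
noncomputable def sumOver (S : ℕ → Finset ℕ) (u : ℕ → ℝ) : ℕ → ℝ := fun N => ∑ n ∈ S N, u n

/-- The truncated arborified zeta values for the sums over the finite sets `S N`. -/
noncomputable def truncZeta (S : ℕ → Finset ℕ) : ForestAlg ℕ+ →ₐ[ℝ] (ℕ → ℝ) :=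
  (branching (sumOver S)).comp (lifting powSeq)

section TruncZeta

variable {S : ℕ → Finset ℕ}

theorem truncZeta_graft (a : ℕ+) (x : ForestAlg ℕ+) :
    truncZeta S (graft a x) = sumOver S (powSeq a * truncZeta S x) := by
  induction x using ForestAlg.induction with
  | forest F => exact branching_lifting_graft _ _ a F
  | add x y hx hy =>
    ext N
    simp [hx, hy, sumOver, mul_add, Finset.sum_add_distrib]
  | smul c x hx =>
    ext N
    simp [hx, sumOver, Finset.mul_sum, mul_left_comm]

/-- The contracted term matches because `powSeq` turns addition of decorations into multiplication.
-/
theorem truncZeta_lambdaShuffle (lam : ℝ)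
    (h : ∀ u v, sumOver S u * sumOver S v = sumOver S (u * sumOver S v)
      + sumOver S (sumOver S u * v) + lam • sumOver S (u * v)) (x y : ForestAlg ℕ+) :
    truncZeta S (lambdaShuffle (fun a b => a + b) lam x y) = truncZeta S x * truncZeta S y := by
  refine map_lambdaShuffle _ _ _ (fun a b x y u v w hu hv hw => ?_) x y
  have hpow : powSeq (a + b) = powSeq a * powSeq b := by
    ext n
    simp [powSeq, pow_add, mul_comm]
  rw [truncZeta_graft, truncZeta_graft, truncZeta_graft, hu, hv, hw, truncZeta_graft,
    truncZeta_graft, h, hpow]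
  simp only [mul_assoc, mul_left_comm, mul_comm]

theorem truncZeta_nonneg (F : Forest ℕ+) (N : ℕ) : 0 ≤ truncZeta S (ofForest F) N := by
  have key (F : Forest ℕ+) (h : ∀ T ∈ F, ∀ N, 0 ≤ truncZeta S (ofForest {T}) N) (N : ℕ) :
      0 ≤ truncZeta S (ofForest F) N := by
    induction F using Multiset.induction with
    | empty => simp [ofForest_zero]
    | cons T F ih =>
      rw [ofForest_cons, map_mul]
      exact mul_nonneg (h T (Multiset.mem_cons_self T F) N)
        (ih fun T hT => h T (Multiset.mem_cons_of_mem hT))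
  refine key F (fun T hT => ?_) N
  clear hT
  induction T using RTree.induction with
  | h T ih =>
    intro N
    rw [ofForest_singleton, truncZeta_graft]
    exact Finset.sum_nonneg fun n _ => mul_nonneg (by unfold powSeq; positivity) (key _ ih n)

/-! ### Logarithmic growth and convergence of the truncated sums -/

/-- The exponent `1/2` serves both settings: `n ^ (1/2) / n ^ 2` is summable and `(1 - t) ^ (-1/2)`
is integrable at `1`. -/
theorem exists_one_add_log_pow_le (k : ℕ) :
    ∃ C : ℝ, ∀ x : ℝ, 1 ≤ x → (1 + Real.log x) ^ k ≤ C * x ^ (1 / 2 : ℝ) := by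
  -- Chosen so that the `k`-th power of `log x ≤ x ^ δ / δ` costs at most `x ^ (1/2)`; `k + 1`
  -- covers `k = 0`.
  set δ : ℝ := 1 / (2 * (k + 1)) with hδ
  have hδ0 : 0 < δ := by positivity
  have hkδ : δ * k ≤ 1 / 2 := by
    rw [hδ, div_mul_eq_mul_div, one_mul, div_le_div_iff₀ (by positivity) (by positivity)]
    linarith
  refine ⟨(1 + 1 / δ) ^ k, fun x hx => ?_⟩
  have h0 : 0 ≤ 1 + Real.log x := by linarith [Real.log_nonneg hx]
  have h1 : 1 + Real.log x ≤ (1 + 1 / δ) * x ^ δ := by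
    have h2 := Real.log_le_rpow_div (zero_le_one.trans hx) hδ0
    have h3 := Real.one_le_rpow hx hδ0.le
    rw [div_eq_mul_one_div] at h2
    linarith
  calc (1 + Real.log x) ^ k ≤ ((1 + 1 / δ) * x ^ δ) ^ k := pow_le_pow_left₀ h0 h1 k
    _ = (1 + 1 / δ) ^ k * x ^ (δ * k) := by
      rw [mul_pow, ← Real.rpow_mul_natCast (zero_le_one.trans hx)]
    _ ≤ (1 + 1 / δ) ^ k * x ^ (1 / 2 : ℝ) :=
      mul_le_mul_of_nonneg_left (Real.rpow_le_rpow_of_exponent_le hx hkδ) (by positivity)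

theorem harmonic_nonneg (n : ℕ) : (0 : ℝ) ≤ harmonic n := by
  unfold harmonic
  push_cast
  positivity

theorem harmonic_mono {m n : ℕ} (h : m ≤ n) : (harmonic m : ℝ) ≤ harmonic n := by
  unfold harmonic
  push_cast
  exact Finset.sum_le_sum_of_subset_of_nonneg (Finset.range_mono h) fun _ _ _ => by positivity

/-- Each vertex costs one harmonic factor: its decoration is at least `1`, so its weight is at most
`1 / n`, and the bound for its children increases with `n`. -/
theorem truncZeta_le (hS : ∀ N, S N ⊆ Finset.Icc 1 N) (F : Forest ℕ+) (N : ℕ) :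
    truncZeta S (ofForest F) N ≤ (harmonic N : ℝ) ^ Forest.size F := by
  have key (F : Forest ℕ+)
      (h : ∀ T ∈ F, ∀ N, truncZeta S (ofForest {T}) N ≤ (harmonic N : ℝ) ^ T.size) (N : ℕ) :
      truncZeta S (ofForest F) N ≤ (harmonic N : ℝ) ^ Forest.size F := by
    induction F using Multiset.induction with
    | empty => simp [ofForest_zero, Forest.size]
    | cons T F ih =>
      have hs : Forest.size (T ::ₘ F) = T.size + Forest.size F := by simp [Forest.size]
      rw [ofForest_cons, map_mul, hs, pow_add]
      exact mul_le_mul (h T (Multiset.mem_cons_self T F) N)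
        (ih fun T hT => h T (Multiset.mem_cons_of_mem hT)) (truncZeta_nonneg _ _)
        (pow_nonneg (harmonic_nonneg N) _)
  refine key F (fun T hT => ?_) N
  clear hT
  induction T using RTree.induction with
  | h T ih =>
    intro N
    rw [ofForest_singleton, truncZeta_graft, RTree.size_eq, add_comm, pow_succ]
    calc ∑ n ∈ S N, powSeq T.root n * truncZeta S (ofForest T.children) n
        ≤ ∑ n ∈ S N, (harmonic N : ℝ) ^ Forest.size T.children * (n : ℝ)⁻¹ := by
          refine Finset.sum_le_sum fun n hn => ?_
          obtain ⟨hn1, hnN⟩ := Finset.mem_Icc.1 (hS N hn)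
          rw [mul_comm]
          refine mul_le_mul ((key _ ih n).trans
            (pow_le_pow_left₀ (harmonic_nonneg n) (harmonic_mono hnN) _)) ?_
            (by unfold powSeq; positivity) (pow_nonneg (harmonic_nonneg N) _)
          have h1 : (1 : ℝ) ≤ n := by exact_mod_cast hn1
          exact inv_anti₀ (by positivity) (le_self_pow₀ h1 T.root.ne_zero)
      _ ≤ ∑ n ∈ Finset.Icc 1 N, (harmonic N : ℝ) ^ Forest.size T.children * (n : ℝ)⁻¹ :=
          Finset.sum_le_sum_of_subset_of_nonneg (hS N) fun n _ _ =>
            mul_nonneg (pow_nonneg (harmonic_nonneg N) _) (by positivity)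
      _ = (harmonic N : ℝ) ^ Forest.size T.children * harmonic N := by
          rw [← Finset.mul_sum, harmonic_eq_sum_Icc]
          push_cast
          rfl

theorem summable_harmonic_pow_div_sq (k : ℕ) :
    Summable fun n : ℕ => (harmonic n : ℝ) ^ k * ((n : ℝ) ^ 2)⁻¹ := by
  obtain ⟨C, hC⟩ := exists_one_add_log_pow_le k
  refine Summable.of_nonneg_of_le (fun n => mul_nonneg (pow_nonneg (harmonic_nonneg n) _)
    (by positivity)) (fun n => ?_)
    ((Real.summable_nat_rpow.2 (show (-3 / 2 : ℝ) < -1 by norm_num)).mul_left C)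
  rcases Nat.eq_zero_or_pos n with rfl | hn
  · norm_num [Real.zero_rpow]
  have h1 : (1 : ℝ) ≤ n := by exact_mod_cast hn
  have h2 : (n : ℝ) ^ (-3 / 2 : ℝ) = (n : ℝ) ^ (1 / 2 : ℝ) * ((n : ℝ) ^ 2)⁻¹ := by
    rw [← Real.rpow_natCast, ← Real.rpow_neg (by positivity), ← Real.rpow_add (by positivity)]
    norm_num
  rw [h2, ← mul_assoc]
  refine mul_le_mul_of_nonneg_right (le_trans ?_ (hC n h1)) (by positivity)
  exact pow_le_pow_left₀ (harmonic_nonneg n) (harmonic_le_one_add_log n) k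

theorem tendsto_truncZeta (hS : ∀ N, S N ⊆ Finset.Icc 1 N) (hmono : Monotone S)
    {x : ForestAlg ℕ+} (hx : x ∈ convStuffle) : ∃ c, Tendsto (truncZeta S x) atTop (𝓝 c) := by
  rw [convStuffle_eq] at hx
  refine forestSpan_induction (p := fun x => ∃ c, Tendsto (truncZeta S x) atTop (𝓝 c)) hx
    (fun F hF => ?_) ⟨0, ?_⟩ (fun x y hx hy => ?_) (fun c x hx => ?_)
  · induction F using Multiset.induction with
    | empty => exact ⟨1, by rw [ofForest_zero, map_one]; exact tendsto_const_nhds⟩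
    | cons T F ih =>
      obtain ⟨c, hc⟩ := ih fun T hT => hF T (Multiset.mem_cons_of_mem hT)
      have hT := hF T (Multiset.mem_cons_self T F)
      have mono : Monotone (truncZeta S (ofForest {T})) := by
        intro M N h
        rw [ofForest_singleton, truncZeta_graft]
        exact Finset.sum_le_sum_of_subset_of_nonneg (hmono h) fun n _ _ =>
          mul_nonneg (by unfold powSeq; positivity) (truncZeta_nonneg _ n)
      have bdd : BddAbove (Set.range (truncZeta S (ofForest {T}))) := by
        -- The decoration at least `2` of the root gives `n ^ (-2)`, and `truncZeta_le` at `n`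
        -- bounds the children.
        refine ⟨∑' n : ℕ, (harmonic n : ℝ) ^ Forest.size T.children * ((n : ℝ) ^ 2)⁻¹, ?_⟩
        rintro _ ⟨N, rfl⟩
        rw [ofForest_singleton, truncZeta_graft]
        refine (Finset.sum_le_sum fun n hn => ?_).trans
          ((summable_harmonic_pow_div_sq _).sum_le_tsum (S N) fun n _ =>
            mul_nonneg (pow_nonneg (harmonic_nonneg n) _) (by positivity))
        have h1 : (1 : ℝ) ≤ n := by exact_mod_cast (Finset.mem_Icc.1 (hS N hn)).1
        rw [Pi.mul_apply, mul_comm]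
        refine mul_le_mul (truncZeta_le hS _ n) ?_ (by unfold powSeq; positivity)
          (pow_nonneg (harmonic_nonneg n) _)
        exact inv_anti₀ (by positivity) (pow_le_pow_right₀ h1 (by exact_mod_cast hT))
      refine ⟨(⨆ N, truncZeta S (ofForest {T}) N) * c, ?_⟩
      rw [ofForest_cons, map_mul]
      exact (tendsto_atTop_ciSup mono bdd).mul hc
  · rw [map_zero]; exact tendsto_const_nhds
  · obtain ⟨c, hc⟩ := hx
    obtain ⟨d, hd⟩ := hy
    exact ⟨c + d, by rw [map_add]; exact hc.add hd⟩
  · obtain ⟨d, hd⟩ := hx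
    exact ⟨c • d, by rw [map_smul]; exact hd.const_smul c⟩

theorem tendsto_limUnder_truncZeta (hS : ∀ N, S N ⊆ Finset.Icc 1 N) (hmono : Monotone S)
    {x : ForestAlg ℕ+} (hx : x ∈ convStuffle) :
    Tendsto (truncZeta S x) atTop (𝓝 (limUnder atTop (truncZeta S x))) :=
  tendsto_nhds_limUnder (tendsto_truncZeta hS hmono hx)

theorem isAlgMorphismOn_limUnder_truncZeta (hS : ∀ N, S N ⊆ Finset.Icc 1 N) (hmono : Monotone S)
    (lam : ℝ) (h : ∀ u v, sumOver S u * sumOver S v = sumOver S (u * sumOver S v)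
      + sumOver S (sumOver S u * v) + lam • sumOver S (u * v)) :
    IsAlgMorphismOn convStuffle (lambdaShuffle (fun a b => a + b) lam)
      fun x => limUnder atTop (truncZeta S x) := by
  refine isAlgMorphismOn_of_tendsto (Z := fun x => truncZeta S x)
    (ofForest_mem_forestSpan (by simp)) (fun x hx y hy => lambdaShuffle_mem_convStuffle lam hx hy)
    (fun x hx => tendsto_limUnder_truncZeta hS hmono hx) ?_ ?_ ?_ ?_ <;>
    refine Eventually.of_forall fun N => ?_
  · rw [ofForest_zero, map_one, Pi.one_apply]
  · intro x _ y _
    rw [map_add, Pi.add_apply]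
  · intro c x _
    rw [map_smul, Pi.smul_apply, smul_eq_mul]
  · intro x _ y _
    rw [truncZeta_lambdaShuffle lam h, Pi.mul_apply]

end TruncZeta

/-! ### Rota–Baxter identities for the two summation operators -/

/-- The pairs `(m, n)` split into `n < m`, `m < n` and the diagonal, which the strict sums miss. The
induction compares increments in `N`. -/
theorem sumOver_Ico_mul (u v : ℕ → ℝ) :
    sumOver (Finset.Ico 1) u * sumOver (Finset.Ico 1) v
      = sumOver (Finset.Ico 1) (u * sumOver (Finset.Ico 1) v)
        + sumOver (Finset.Ico 1) (sumOver (Finset.Ico 1) u * v)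
        + (1 : ℝ) • sumOver (Finset.Ico 1) (u * v) := by
  ext N
  simp only [sumOver, Pi.mul_apply, Pi.add_apply, Pi.smul_apply, smul_eq_mul, one_mul]
  induction N with
  | zero => simp
  | succ N ih =>
    rcases Nat.eq_zero_or_pos N with rfl | hN
    · simp
    · simp only [Finset.sum_Ico_succ_top hN]
      linear_combination ih

/-- The regions `n ≤ m` and `m ≤ n` count the diagonal twice, whence the weight `-1`. -/
theorem sumOver_Icc_mul (u v : ℕ → ℝ) :
    sumOver (Finset.Icc 1) u * sumOver (Finset.Icc 1) v
      = sumOver (Finset.Icc 1) (u * sumOver (Finset.Icc 1) v)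
        + sumOver (Finset.Icc 1) (sumOver (Finset.Icc 1) u * v)
        + (-1 : ℝ) • sumOver (Finset.Icc 1) (u * v) := by
  ext N
  simp only [sumOver, Pi.mul_apply, Pi.add_apply, Pi.smul_apply, smul_eq_mul]
  induction N with
  | zero => simp
  | succ N ih =>
    simp only [Finset.sum_Icc_succ_top (Nat.le_add_left 1 N)]
    linear_combination ih

theorem tendsto_partialStuffle {v : ForestAlg ℕ+} (hv : v ∈ convStuffle) :
    Tendsto (partialStuffle v) atTop (𝓝 (zetaStuffle v)) :=
  tendsto_limUnder_truncZeta (S := Finset.Ico 1)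
    (fun _ => Finset.Ico_subset_Icc_self) (fun _ _ h => Finset.Ico_subset_Ico_right h) hv

theorem isAlgMorphismOn_zetaStuffle : IsAlgMorphismOn convStuffle treeStuffle zetaStuffle :=
  isAlgMorphismOn_limUnder_truncZeta (S := Finset.Ico 1)
    (fun _ => Finset.Ico_subset_Icc_self) (fun _ _ h => Finset.Ico_subset_Ico_right h) 1
    sumOver_Ico_mul

theorem tendsto_partialStuffleStar {v : ForestAlg ℕ+} (hv : v ∈ convStuffle) :
    Tendsto (partialStuffleStar v) atTop (𝓝 (zetaStuffleStar v)) :=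
  tendsto_limUnder_truncZeta (S := Finset.Icc 1)
    (fun _ => subset_rfl) (fun _ _ h => Finset.Icc_subset_Icc_right h) hv

theorem isAlgMorphismOn_zetaStuffleStar :
    IsAlgMorphismOn convStuffle treeAntiStuffle zetaStuffleStar :=
  isAlgMorphismOn_limUnder_truncZeta (S := Finset.Icc 1)
    (fun _ => subset_rfl) (fun _ _ h => Finset.Icc_subset_Icc_right h) (-1) sumOver_Icc_mul

/-! ### Arborified iterated integrals -/

open Set in
theorem intervalIntegrable_of_continuousOn_Ioo {f : ℝ → ℝ} (hf : ContinuousOn f (Ioo 0 1))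
    {a b : ℝ} (ha : a ∈ Ioo (0 : ℝ) 1) (hb : b ∈ Ioo (0 : ℝ) 1) :
    IntervalIntegrable f MeasureTheory.volume a b :=
  (hf.mono (ordConnected_Ioo.uIcc_subset ha hb)).intervalIntegrable

open Set in
theorem hasDerivAt_intOp {f : ℝ → ℝ} (hf : ContinuousOn f (Ioo 0 1)) {ε z : ℝ}
    (hε : ε ∈ Ioo (0 : ℝ) 1) (hz : z ∈ Ioo (0 : ℝ) 1) : HasDerivAt (intOp ε f) (f z) z :=
  intervalIntegral.integral_hasDerivAt_right (intervalIntegrable_of_continuousOn_Ioo hf hε hz)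
    (hf.stronglyMeasurableAtFilter isOpen_Ioo z hz) (hf.continuousAt (isOpen_Ioo.mem_nhds hz))

open Set in
theorem continuousOn_intOp {f : ℝ → ℝ} (hf : ContinuousOn f (Ioo 0 1)) {ε : ℝ}
    (hε : ε ∈ Ioo (0 : ℝ) 1) : ContinuousOn (intOp ε f) (Ioo 0 1) :=
  fun _ hz => (hasDerivAt_intOp hf hε hz).continuousAt.continuousWithinAt

open Set in
-- Integration by parts; the boundary term at `ε` vanishes. This is the Rota–Baxter identity of
-- weight `0`.
theorem intOp_mul_intOp {f g : ℝ → ℝ} (hf : ContinuousOn f (Ioo 0 1))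
    (hg : ContinuousOn g (Ioo 0 1)) {ε z : ℝ} (hε : ε ∈ Ioo (0 : ℝ) 1) (hz : z ∈ Ioo (0 : ℝ) 1) :
    intOp ε f z * intOp ε g z = intOp ε (f * intOp ε g) z + intOp ε (intOp ε f * g) z := by
  have hsub : uIcc ε z ⊆ Ioo 0 1 := ordConnected_Ioo.uIcc_subset hε hz
  have h := intervalIntegral.integral_deriv_mul_eq_sub
    (fun t ht => hasDerivAt_intOp hf hε (hsub ht)) (fun t ht => hasDerivAt_intOp hg hε (hsub ht))
    (intervalIntegrable_of_continuousOn_Ioo hf hε hz)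
    (intervalIntegrable_of_continuousOn_Ioo hg hε hz)
  have h0 : intOp ε f ε = 0 := intervalIntegral.integral_same
  rw [h0, zero_mul, sub_zero] at h
  rw [← h]
  exact intervalIntegral.integral_add
    (intervalIntegrable_of_continuousOn_Ioo (hf.mul (continuousOn_intOp hg hε)) hε hz)
    (intervalIntegrable_of_continuousOn_Ioo ((continuousOn_intOp hf hε).mul hg) hε hz)

open Set in
theorem continuousOn_sigmaXY (a : XY) : ContinuousOn (sigmaXY a) (Ioo 0 1) := by
  cases a
  · exact continuousOn_const.div continuousOn_id fun t ht => ht.1.ne'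
  · exact continuousOn_const.div (continuousOn_const.sub continuousOn_id)
      fun t ht => (sub_pos.2 ht.2).ne'

theorem sigmaXY_nonneg (a : XY) {t : ℝ} (ht : t ∈ Set.Ioo (0 : ℝ) 1) : 0 ≤ sigmaXY a t := by
  cases a
  · exact (one_div_pos.2 ht.1).le
  · exact (one_div_pos.2 (sub_pos.2 ht.2)).le

section ChenInt

variable (ε : ℝ)

/-- The arborified iterated integrals, as an algebra morphism. -/
noncomputable def chenHom : ForestAlg XY →ₐ[ℝ] (ℝ → ℝ) :=
  (branching (intOp ε)).comp (lifting sigmaXY)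

theorem chenInt_one : chenInt ε (ofForest 0) = 1 := map_one (chenHom ε)

theorem chenInt_zero : chenInt ε 0 = 0 := map_zero (chenHom ε)

theorem chenInt_add (v w : ForestAlg XY) : chenInt ε (v + w) = chenInt ε v + chenInt ε w :=
  map_add (chenHom ε) v w

theorem chenInt_mul (v w : ForestAlg XY) : chenInt ε (v * w) = chenInt ε v * chenInt ε w :=
  map_mul (chenHom ε) v w

theorem chenInt_smul (c : ℝ) (v : ForestAlg XY) : chenInt ε (c • v) = c • chenInt ε v :=
  map_smul (chenHom ε) c v

theorem chenInt_tree (T : RTree XY) :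
    chenInt ε (ofForest {T}) = intOp ε (sigmaXY T.root * chenInt ε (ofForest T.children)) := by
  rw [ofForest_singleton]
  exact branching_lifting_graft _ _ _ _

/-- To prove a property of the iterated integrals of all the forests made of some given trees, it
suffices to check that it is multiplicative. -/
theorem chenInt_forest_induction {p : Forest XY → (ℝ → ℝ → ℝ) → Prop} (F : Forest XY)
    (one : p 0 fun _ => 1)
    (mul : ∀ T F (f g : ℝ → ℝ → ℝ), p {T} f → p F g → p (T ::ₘ F) (f * g))
    (tree : ∀ T ∈ F, p {T} fun ε => chenInt ε (ofForest {T})) :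
    p F fun ε => chenInt ε (ofForest F) := by
  induction F using Multiset.induction with
  | empty => simpa only [chenInt_one] using one
  | cons T F ih =>
    simp only [ofForest_cons, chenInt_mul]
    exact mul T F _ _ (tree T (Multiset.mem_cons_self T F))
      (ih fun T hT => tree T (Multiset.mem_cons_of_mem hT))

end ChenInt

open Set in
/-- Functions of `0 < ε ≤ z < 1` that behave like the iterated integrals from `ε` to `z` of
nonnegative continuous functions. -/
structure IsIntegralLike (G : ℝ → ℝ → ℝ) : Prop where
  continuousOn : ∀ ε ∈ Ioo (0 : ℝ) 1, ContinuousOn (G ε) (Ioo 0 1)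
  nonneg : ∀ ε z, 0 < ε → ε ≤ z → z < 1 → 0 ≤ G ε z
  mono : ∀ ε' ε z z', 0 < ε' → ε' ≤ ε → ε ≤ z → z ≤ z' → z' < 1 → G ε z ≤ G ε' z'

theorem IsIntegralLike.mul {G H : ℝ → ℝ → ℝ} (hG : IsIntegralLike G) (hH : IsIntegralLike H) :
    IsIntegralLike (G * H) where
  continuousOn ε hε := (hG.continuousOn ε hε).mul (hH.continuousOn ε hε)
  nonneg ε z h0 h h1 := mul_nonneg (hG.nonneg ε z h0 h h1) (hH.nonneg ε z h0 h h1)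
  mono ε' ε z z' h0 h1 h2 h3 h4 := mul_le_mul (hG.mono ε' ε z z' h0 h1 h2 h3 h4)
    (hH.mono ε' ε z z' h0 h1 h2 h3 h4) (hH.nonneg ε z (h0.trans_le h1) h2 (h3.trans_lt h4))
    (hG.nonneg ε' z' h0 ((h1.trans h2).trans h3) h4)

open Set in
-- Lowering `ε` enlarges both the integrand, which itself depends on `ε`, and the interval of
-- integration.
theorem IsIntegralLike.intOp {G : ℝ → ℝ → ℝ} (hG : IsIntegralLike G) (a : XY) :
    IsIntegralLike fun ε => intOp ε (sigmaXY a * G ε) := by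
  have hcont : ∀ ε ∈ Ioo (0 : ℝ) 1, ContinuousOn (sigmaXY a * G ε) (Ioo 0 1) := fun ε hε =>
    (continuousOn_sigmaXY a).mul (hG.continuousOn ε hε)
  have hnonneg : ∀ ε t, 0 < ε → ε ≤ t → t < 1 → 0 ≤ (sigmaXY a * G ε) t := fun ε t h0 h h1 =>
    mul_nonneg (sigmaXY_nonneg a ⟨h0.trans_le h, h1⟩) (hG.nonneg ε t h0 h h1)
  refine ⟨fun ε hε => continuousOn_intOp (hcont ε hε) hε, fun ε z h0 h h1 => ?_,
    fun ε' ε z z' h0 h1 h2 h3 h4 => ?_⟩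
  · exact intervalIntegral.integral_nonneg h fun t ht =>
      hnonneg ε t h0 ht.1 (ht.2.trans_lt h1)
  · have mε' : ε' ∈ Ioo (0 : ℝ) 1 := ⟨h0, by linarith⟩
    have mε : ε ∈ Ioo (0 : ℝ) 1 := ⟨by linarith, by linarith⟩
    have mz : z ∈ Ioo (0 : ℝ) 1 := ⟨by linarith, by linarith⟩
    have mz' : z' ∈ Ioo (0 : ℝ) 1 := ⟨by linarith, by linarith⟩
    calc ∫ t in ε..z, (sigmaXY a * G ε) t ≤ ∫ t in ε..z, (sigmaXY a * G ε') t := by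
          refine intervalIntegral.integral_mono_on h2
            (intervalIntegrable_of_continuousOn_Ioo (hcont ε mε) mε mz)
            (intervalIntegrable_of_continuousOn_Ioo (hcont ε' mε') mε mz) fun t ht => ?_
          exact mul_le_mul_of_nonneg_left
            (hG.mono ε' ε t t h0 h1 ht.1 le_rfl (ht.2.trans_lt mz.2))
            (sigmaXY_nonneg a ⟨mε.1.trans_le ht.1, ht.2.trans_lt mz.2⟩)
      _ ≤ ∫ t in ε'..z', (sigmaXY a * G ε') t := by
          refine intervalIntegral.integral_mono_interval h1 h2 h3 ?_
            (intervalIntegrable_of_continuousOn_Ioo (hcont ε' mε') mε' mz')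
          refine (MeasureTheory.ae_restrict_iff' measurableSet_Ioc).2
            (MeasureTheory.ae_of_all _ fun t ht => ?_)
          exact hnonneg ε' t h0 ht.1.le (ht.2.trans_lt h4)

theorem isIntegralLike_chenInt (F : Forest XY) :
    IsIntegralLike fun ε => chenInt ε (ofForest F) := by
  have one : IsIntegralLike fun _ => 1 := ⟨fun _ _ => continuousOn_const, fun _ _ _ _ _ => zero_le_one,
    fun _ _ _ _ _ _ _ _ _ => le_rfl⟩
  have key (F : Forest XY) (h : ∀ T ∈ F, IsIntegralLike fun ε => chenInt ε (ofForest {T})) :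
      IsIntegralLike fun ε => chenInt ε (ofForest F) :=
    chenInt_forest_induction (p := fun _ => IsIntegralLike) F one
      (fun _ _ _ _ hf hg => hf.mul hg) h
  refine key F fun T hT => ?_
  clear hT
  induction T using RTree.induction with
  | h T ih =>
    simp only [chenInt_tree]
    exact (key _ ih).intOp _

open Set in
theorem continuousOn_chenInt {ε : ℝ} (hε : ε ∈ Ioo (0 : ℝ) 1) (v : ForestAlg XY) :
    ContinuousOn (chenInt ε v) (Ioo 0 1) := by
  induction v using ForestAlg.induction with
  | forest F => exact (isIntegralLike_chenInt F).continuousOn ε hε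
  | add v w hv hw => rw [chenInt_add]; exact hv.add hw
  | smul c v hv => rw [chenInt_smul]; exact hv.const_smul c

open Set in
-- Additivity of the integral needs integrability, so beyond forests the formula is proved only for
-- `ε` and `z` in `(0, 1)`.
theorem chenInt_graft {ε z : ℝ} (hε : ε ∈ Ioo (0 : ℝ) 1) (hz : z ∈ Ioo (0 : ℝ) 1) (a : XY)
    (v : ForestAlg XY) : chenInt ε (graft a v) z = intOp ε (sigmaXY a * chenInt ε v) z := by
  induction v using ForestAlg.induction with
  | forest F => exact congrFun (branching_lifting_graft _ _ a F) z
  | add v w hv hw =>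
    have hi (v : ForestAlg XY) := intervalIntegrable_of_continuousOn_Ioo
      ((continuousOn_sigmaXY a).mul (continuousOn_chenInt hε v)) hε hz
    rw [map_add, chenInt_add, Pi.add_apply, hv, hw, chenInt_add, mul_add]
    exact (intervalIntegral.integral_add (hi v) (hi w)).symm
  | smul c v hv =>
    rw [map_smul, chenInt_smul, Pi.smul_apply, hv, chenInt_smul, mul_smul_comm]
    exact (intervalIntegral.integral_smul c _).symm

open Set in
theorem chenInt_treeShuffle {ε z : ℝ} (hε : ε ∈ Ioo (0 : ℝ) 1) (hz : z ∈ Ioo (0 : ℝ) 1)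
    (v w : ForestAlg XY) : chenInt ε (treeShuffle v w) z = chenInt ε v z * chenInt ε w z := by
  -- Restriction to `(0, 1)`, where the integrands are continuous and integration by parts is
  -- available.
  let Φ : ForestAlg XY →ₐ[ℝ] (Ioo (0 : ℝ) 1 → ℝ) :=
    AlgHom.pi fun z => (Pi.evalAlgHom ℝ (fun _ : ℝ => ℝ) z.1).comp (chenHom ε)
  have hΦ (v : ForestAlg XY) (z : Ioo (0 : ℝ) 1) : Φ v z = chenInt ε v z := rfl
  refine congrFun (map_lambdaShuffle _ _ Φ (fun a b x y u v w hu hv _ => ?_) v w) ⟨z, hz⟩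
  rw [zero_smul, add_zero]
  have intOp_congr {f g : ℝ → ℝ} (h : ∀ t ∈ Ioo (0 : ℝ) 1, f t = g t) (z : Ioo (0 : ℝ) 1) :
      intOp ε f z = intOp ε g z :=
    intervalIntegral.integral_congr fun t ht => h t (ordConnected_Ioo.uIcc_subset hε z.2 ht)
  ext z
  rw [Pi.add_apply, Pi.mul_apply, hΦ, hΦ, hΦ, hΦ, chenInt_graft hε z.2, chenInt_graft hε z.2,
    chenInt_graft hε z.2, chenInt_graft hε z.2,
    intOp_mul_intOp ((continuousOn_sigmaXY a).mul (continuousOn_chenInt hε x))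
      ((continuousOn_sigmaXY b).mul (continuousOn_chenInt hε y)) hε z.2]
  congr 1
  · refine intOp_congr (fun t ht => ?_) z
    have h := congrFun hu ⟨t, ht⟩
    rw [Pi.mul_apply, hΦ, hΦ, hΦ, chenInt_graft hε ht] at h
    simp only [Pi.mul_apply, h, mul_assoc]
  · refine intOp_congr (fun t ht => ?_) z
    have h := congrFun hv ⟨t, ht⟩
    rw [Pi.mul_apply, hΦ, hΦ, hΦ, chenInt_graft hε ht] at h
    simp only [Pi.mul_apply, h]
    ring

/-! ### Semiconvergent forests -/

theorem IsSemiconvergent.of_mem {F : Forest XY} (hF : IsSemiconvergent F) {T : RTree XY}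
    (hT : T ∈ F) : IsSemiconvergent {T} := by
  intro _ hT'
  rw [Multiset.mem_singleton.1 hT']
  exact hF T hT

theorem IsSemiconvergent.children {T : RTree XY} (h : IsSemiconvergent {T}) :
    IsSemiconvergent T.children := fun _ hT' S hS =>
  h T (Multiset.mem_singleton_self T) S (.child hT' hS)

theorem IsSemiconvergent.children_eq {T : RTree XY} (h : IsSemiconvergent {T})
    (hx : T.root = XY.x) : ∃ T', T.children = {T'} := by
  rw [← Multiset.card_eq_one]
  by_contra hc
  have hy := h T (Multiset.mem_singleton_self T) T .refl (by omega)
  rw [hx] at hy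
  exact XY.noConfusion hy

theorem isSemiconvergent_node {a : XY} {F : Forest XY} (hF : IsSemiconvergent F)
    (ha : a = XY.y ∨ F.card = 1) : IsSemiconvergent {RTree.node a F} := by
  intro T hT S hS hc
  rw [Multiset.mem_singleton.1 hT] at hS
  cases hS with
  | refl =>
    rw [RTree.children_node] at hc
    rw [RTree.root_node]
    rcases ha with ha | ha
    · exact ha
    · omega
  | child h1 h2 =>
    rw [RTree.children_node] at h1
    exact hF _ h1 S h2 hc

/-- The two claims need a common induction. Grafting on `y` preserves semiconvergence always, on `x`
only for a single tree. A tree with root `x` has one child, so the recursive term below that root is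
again a shuffle of two trees, hence a combination of trees. -/
theorem treeShuffle_mem_forestSpan (F G : Forest XY) (hF : IsSemiconvergent F)
    (hG : IsSemiconvergent G) :
    shuffleForest (fun a _ => a) 0 F G ∈ forestSpan IsSemiconvergent ∧
      (F.card = 1 → G.card = 1 → shuffleForest (fun a _ => a) 0 F G ∈
        forestSpan fun H => IsSemiconvergent H ∧ H.card = 1) := by
  induction hn : Forest.size F + Forest.size G using Nat.strong_induction_on
    generalizing F G with
  | _ n ih =>
    have tree : ∀ T ∈ F, ∀ t ∈ G, shuffleForest (fun a _ => a) 0 {T} {t} ∈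
        forestSpan fun H => IsSemiconvergent H ∧ H.card = 1 := by
      intro T hT t ht
      have h1 := Forest.size_le_of_mem hT
      have h2 := Forest.size_le_of_mem ht
      have h3 := RTree.size_eq T
      have h4 := RTree.size_eq t
      have h5 := Forest.size_singleton T
      have h6 := Forest.size_singleton t
      have hT' := hF.of_mem hT
      have ht' := hG.of_mem ht
      have hl := ih _ (by omega) T.children {t} hT'.children ht' rfl
      have hr := ih _ (by omega) {T} t.children hT' ht'.children rfl
      have graft_mem (a : XY) {z : ForestAlg XY} (hz : z ∈ forestSpan IsSemiconvergent)
          (hz' : a = XY.x → z ∈ forestSpan fun H => IsSemiconvergent H ∧ H.card = 1) :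
          graft a z ∈ forestSpan fun H => IsSemiconvergent H ∧ H.card = 1 := by
        cases a with
        | x => exact graft_mem_forestSpan _ (fun H hH =>
            ⟨isSemiconvergent_node hH.1 (.inr hH.2), Multiset.card_singleton _⟩) (hz' rfl)
        | y => exact graft_mem_forestSpan _ (fun H hH =>
            ⟨isSemiconvergent_node hH (.inl rfl), Multiset.card_singleton _⟩) hz
      rw [shuffleForest_tree, zero_smul, add_zero]
      refine add_mem (graft_mem _ hl.1 fun hx => ?_) (graft_mem _ hr.1 fun hx => ?_)
      · obtain ⟨T', h⟩ := hT'.children_eq hx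
        exact hl.2 (by rw [h, Multiset.card_singleton]) (Multiset.card_singleton _)
      · obtain ⟨t', h⟩ := ht'.children_eq hx
        exact hr.2 (Multiset.card_singleton _) (by rw [h, Multiset.card_singleton])
    refine ⟨shuffleForest_mem_forestSpan _ _ hF hG fun T hT t ht => ?_, fun h1 h2 => ?_⟩
    · refine Submodule.span_mono ?_ (tree T hT t ht)
      rintro _ ⟨H, hH, rfl⟩
      exact ⟨H, hH.1, rfl⟩
    · obtain ⟨T, rfl⟩ := Multiset.card_eq_one.1 h1
      obtain ⟨t, rfl⟩ := Multiset.card_eq_one.1 h2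
      exact tree T (Multiset.mem_singleton_self T) t (Multiset.mem_singleton_self t)

/-- Convergence becomes a condition on each tree, the form that `shuffleForest_mem_forestSpan`
takes. -/
theorem convShuffle_eq : convShuffle = forestSpan fun F =>
    ∀ T ∈ F, IsSemiconvergent {T} ∧ T.root = XY.x := by
  unfold convShuffle forestSpan
  congr 1
  ext v
  refine exists_congr fun F => ?_
  rw [← and_assoc]
  refine and_congr_left fun _ => ⟨fun h T hT => ⟨h.1.of_mem hT, h.2 T hT⟩, fun h =>
    ⟨fun T hT => (h T hT).1 T (Multiset.mem_singleton_self T), fun T hT => (h T hT).2⟩⟩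

theorem treeShuffle_mem_convShuffle {v w : ForestAlg XY} (hv : v ∈ convShuffle)
    (hw : w ∈ convShuffle) : treeShuffle v w ∈ convShuffle := by
  rw [convShuffle_eq] at *
  refine lambdaShuffle_mem_forestSpan _ _ (fun F G hF hG => ?_) hv hw
  refine shuffleForest_mem_forestSpan _ _ hF hG fun T hT t ht => ?_
  obtain ⟨hT1, hT2⟩ := hF T hT
  obtain ⟨ht1, ht2⟩ := hG t ht
  obtain ⟨T', hT'⟩ := hT1.children_eq hT2
  obtain ⟨t', ht'⟩ := ht1.children_eq ht2
  have graft_mem {z : ForestAlg XY}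
      (hz : z ∈ forestSpan fun H => IsSemiconvergent H ∧ H.card = 1) :
      graft XY.x z ∈ forestSpan fun F => ∀ T ∈ F, IsSemiconvergent {T} ∧ T.root = XY.x :=
    graft_mem_forestSpan _ (fun H hH S hS => by
      rw [Multiset.mem_singleton.1 hS]
      exact ⟨isSemiconvergent_node hH.1 (.inr hH.2), rfl⟩) hz
  rw [shuffleForest_tree, zero_smul, add_zero, hT2, ht2]
  refine add_mem (graft_mem ?_) (graft_mem ?_)
  · exact (treeShuffle_mem_forestSpan _ _ hT1.children ht1).2
      (by rw [hT', Multiset.card_singleton]) (Multiset.card_singleton _)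
  · exact (treeShuffle_mem_forestSpan _ _ hT1 ht1.children).2
      (Multiset.card_singleton _) (by rw [ht', Multiset.card_singleton])

/-! ### Bounds for the iterated integrals -/

/-- The function `1 - log (1 - z)`. -/
noncomputable def oneSubLog (z : ℝ) : ℝ := 1 - Real.log (1 - z)

theorem one_le_oneSubLog {z : ℝ} (h0 : 0 ≤ z) (h1 : z < 1) : 1 ≤ oneSubLog z := by
  unfold oneSubLog
  linarith [Real.log_nonpos (sub_nonneg.2 h1.le) (by linarith)]

theorem oneSubLog_mono {t z : ℝ} (h : t ≤ z) (h1 : z < 1) : oneSubLog t ≤ oneSubLog z := by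
  unfold oneSubLog
  linarith [Real.log_le_log (sub_pos.2 h1) (by linarith : 1 - z ≤ 1 - t)]

/-- Equivalent to `-(1 - z) log (1 - z) ≤ z`. It regains a factor `z` after integrating against
`σ_y`. -/
theorem oneSubLog_sub_one_le {z : ℝ} (h1 : z < 1) : oneSubLog z - 1 ≤ z * oneSubLog z := by
  unfold oneSubLog
  have hz : 0 < 1 - z := sub_pos.2 h1
  have h := mul_le_mul_of_nonneg_left (Real.one_sub_inv_le_log_of_pos hz) hz.le
  rw [mul_sub, mul_one, mul_inv_cancel₀ hz.ne'] at h
  linarith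

theorem hasDerivAt_oneSubLog {z : ℝ} (h1 : z < 1) : HasDerivAt oneSubLog (sigmaXY XY.y z) z := by
  have h := (((hasDerivAt_id z).const_sub 1).log (sub_pos.2 h1).ne').const_sub 1
  rwa [show -(-1 / (1 - id z)) = sigmaXY XY.y z by simp only [sigmaXY, id, neg_div, neg_neg]] at h

open Set in
theorem integral_sigmaXY_y {ε z : ℝ} (hε : ε ∈ Ioo (0 : ℝ) 1) (hz : z ∈ Ioo (0 : ℝ) 1) :
    ∫ t in ε..z, sigmaXY XY.y t = oneSubLog z - oneSubLog ε :=
  intervalIntegral.integral_eq_sub_of_hasDerivAt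
    (fun _ ht => hasDerivAt_oneSubLog (ordConnected_Ioo.uIcc_subset hε hz ht).2)
    (intervalIntegrable_of_continuousOn_Ioo (continuousOn_sigmaXY _) hε hz)

open Set in
theorem intOp_le {f g : ℝ → ℝ} (hf : ContinuousOn f (Ioo 0 1)) (hg : ContinuousOn g (Ioo 0 1))
    {ε z : ℝ} (h0 : 0 < ε) (h : ε ≤ z) (h1 : z < 1) (hfg : ∀ t ∈ Icc ε z, f t ≤ g t) :
    intOp ε f z ≤ intOp ε g z :=
  intervalIntegral.integral_mono_on h
    (intervalIntegrable_of_continuousOn_Ioo hf ⟨h0, h.trans_lt h1⟩ ⟨h0.trans_le h, h1⟩)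
    (intervalIntegrable_of_continuousOn_Ioo hg ⟨h0, h.trans_lt h1⟩ ⟨h0.trans_le h, h1⟩) hfg

theorem chenInt_nonneg (F : Forest XY) {ε z : ℝ} (h0 : 0 < ε) (h : ε ≤ z) (h1 : z < 1) :
    0 ≤ chenInt ε (ofForest F) z :=
  (isIntegralLike_chenInt F).nonneg ε z h0 h h1

theorem chenInt_tree_integrand_le {T T' : RTree XY} (hx : T.root = XY.x) (hT' : T.children = {T'})
    {ε t : ℝ} (h0 : 0 < t) {k : ℕ} (h : chenInt ε (ofForest {T'}) t ≤ t * oneSubLog t ^ k) :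
    (sigmaXY T.root * chenInt ε (ofForest T.children)) t ≤ oneSubLog t ^ k := by
  rw [hx, hT', Pi.mul_apply]
  calc 1 / t * chenInt ε (ofForest {T'}) t ≤ 1 / t * (t * oneSubLog t ^ k) :=
        mul_le_mul_of_nonneg_left h (one_div_pos.2 h0).le
    _ = oneSubLog t ^ k := by field_simp

/-- The factor `z` is what lets the induction pass through `σ_x = 1 / t`. At a root `x` it comes
back as the length of the interval. At a root `y` the factors of the children are discarded, and `∫
σ_y = L(z) - L(ε) ≤ L(z) - 1 ≤ z L(z)` supplies a new one. -/
theorem chenInt_tree_le (T : RTree XY) (hT : IsSemiconvergent {T}) {ε z : ℝ} (h0 : 0 < ε)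
    (h : ε ≤ z) (h1 : z < 1) :
    chenInt ε (ofForest {T}) z ≤ z * oneSubLog z ^ T.size := by
  induction T using RTree.induction generalizing z with
  | h T ih =>
    have hε : ε ∈ Set.Ioo (0 : ℝ) 1 := ⟨h0, h.trans_lt h1⟩
    have hz : z ∈ Set.Ioo (0 : ℝ) 1 := ⟨h0.trans_le h, h1⟩
    have hL := one_le_oneSubLog hz.1.le h1
    have hcont := (continuousOn_sigmaXY T.root).mul (continuousOn_chenInt hε (ofForest T.children))
    rw [chenInt_tree]
    cases hroot : T.root with
    | x =>
      rw [← hroot]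
      obtain ⟨T', hT'⟩ := hT.children_eq hroot
      have hsize : T.size = T'.size + 1 := by
        rw [RTree.size_eq, hT', Forest.size_singleton, add_comm]
      calc intOp ε (sigmaXY T.root * chenInt ε (ofForest T.children)) z
          ≤ intOp ε (fun _ => oneSubLog z ^ T'.size) z := by
            refine intOp_le hcont continuousOn_const h0 h h1 fun t ht => ?_
            have ht0 : 0 < t := h0.trans_le ht.1
            have ht1 : t < 1 := ht.2.trans_lt h1
            have hmem : T' ∈ T.children := by rw [hT']; exact Multiset.mem_singleton_self T'
            refine (chenInt_tree_integrand_le hroot hT' ht0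
              (ih T' hmem (hT.children.of_mem hmem) ht.1 ht1)).trans ?_
            exact pow_le_pow_left₀ (zero_le_one.trans (one_le_oneSubLog ht0.le ht1))
              (oneSubLog_mono ht.2 h1) _
        _ = (z - ε) * oneSubLog z ^ T'.size := by
            rw [intOp, intervalIntegral.integral_const, smul_eq_mul]
        _ ≤ z * oneSubLog z ^ T.size :=
            mul_le_mul (by linarith) (pow_le_pow_right₀ hL (by omega)) (by positivity) hz.1.le
    | y =>
      have hforest (t : ℝ) (ht : ε ≤ t) (ht1 : t < 1) : chenInt ε (ofForest T.children) t
          ≤ oneSubLog t ^ Forest.size T.children := by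
        have ht0 : 0 < t := h0.trans_le ht
        have hLt := one_le_oneSubLog ht0.le ht1
        refine (chenInt_forest_induction (p := fun F f =>
          0 ≤ f ε t ∧ f ε t ≤ oneSubLog t ^ Forest.size F) T.children ?_ ?_ ?_).2
        · simp [Forest.size]
        · intro S F f g hf hg
          have hs : Forest.size (S ::ₘ F) = Forest.size {S} + Forest.size F := by
            simp [Forest.size]
          rw [hs, pow_add]
          exact ⟨mul_nonneg hf.1 hg.1, mul_le_mul hf.2 hg.2 hg.1 (by positivity)⟩
        · intro S hS
          rw [Forest.size_singleton]
          exact ⟨chenInt_nonneg _ h0 ht ht1, (ih S hS (hT.children.of_mem hS) ht ht1).trans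
            (mul_le_of_le_one_left (by positivity) ht1.le)⟩
      rw [hroot] at hcont
      have hsize : T.size = Forest.size T.children + 1 := by rw [RTree.size_eq, add_comm]
      calc intOp ε (sigmaXY XY.y * chenInt ε (ofForest T.children)) z
          ≤ intOp ε (fun t => sigmaXY XY.y t * oneSubLog z ^ Forest.size T.children) z := by
            refine intOp_le hcont ((continuousOn_sigmaXY _).mul continuousOn_const) h0 h h1
              fun t ht => ?_
            have ht0 : 0 < t := h0.trans_le ht.1
            have ht1 : t < 1 := ht.2.trans_lt h1
            refine mul_le_mul_of_nonneg_left ((hforest t ht.1 ht1).trans ?_)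
              (sigmaXY_nonneg _ ⟨ht0, ht1⟩)
            exact pow_le_pow_left₀ (zero_le_one.trans (one_le_oneSubLog ht0.le ht1))
              (oneSubLog_mono ht.2 h1) _
        _ = (oneSubLog z - oneSubLog ε) * oneSubLog z ^ Forest.size T.children := by
            rw [intOp, intervalIntegral.integral_mul_const, integral_sigmaXY_y hε hz]
        _ ≤ (z * oneSubLog z) * oneSubLog z ^ Forest.size T.children := by
            refine mul_le_mul_of_nonneg_right ?_ (by positivity)
            linarith [one_le_oneSubLog hε.1.le hε.2, oneSubLog_sub_one_le h1]
        _ = z * oneSubLog z ^ T.size := by rw [hsize]; ring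

theorem hasDerivAt_sqrt_one_sub {t : ℝ} (h1 : t < 1) :
    HasDerivAt (fun t => -2 * √(1 - t)) (√(1 - t))⁻¹ t := by
  have h := (((hasDerivAt_id t).const_sub 1).sqrt (sub_pos.2 h1).ne').const_mul (-2)
  have h0 : √(1 - t) ≠ 0 := (Real.sqrt_pos.2 (sub_pos.2 h1)).ne'
  rwa [show -2 * (-1 / (2 * √(1 - id t))) = (√(1 - t))⁻¹ by simp only [id]; field_simp] at h

theorem exists_oneSubLog_pow_le (k : ℕ) :
    ∃ C : ℝ, 0 ≤ C ∧ ∀ t ∈ Set.Ioo (0 : ℝ) 1, oneSubLog t ^ k ≤ C * (√(1 - t))⁻¹ := by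
  obtain ⟨C, hC⟩ := exists_one_add_log_pow_le k
  refine ⟨C, zero_le_one.trans (by simpa using hC 1 le_rfl), fun t ht => ?_⟩
  -- At `x = 1 / (1 - t)` the quantity `1 + log x` is `oneSubLog t`.
  have h := hC (1 - t)⁻¹ ((one_le_inv₀ (sub_pos.2 ht.2)).2 (by linarith [ht.1]))
  rwa [Real.log_inv, ← sub_eq_add_neg, Real.inv_rpow (sub_nonneg.2 ht.2.le),
    ← Real.sqrt_eq_rpow] at h

theorem chenInt_tree_bounded {T : RTree XY} (hT : IsSemiconvergent {T}) (hx : T.root = XY.x) :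
    ∃ M, ∀ ε z, 0 < ε → ε ≤ z → z < 1 → chenInt ε (ofForest {T}) z ≤ M := by
  obtain ⟨T', hT'⟩ := hT.children_eq hx
  have hmem : T' ∈ T.children := by rw [hT']; exact Multiset.mem_singleton_self T'
  obtain ⟨C, hC0, hC⟩ := exists_oneSubLog_pow_le T'.size
  -- Here `2` is the integral of `(1 - t) ^ (-1/2)` over `(0, 1)`, so the bound is uniform in `ε`
  -- and `z`.
  refine ⟨C * 2, fun ε z h0 h h1 => ?_⟩
  have hε : ε ∈ Set.Ioo (0 : ℝ) 1 := ⟨h0, h.trans_lt h1⟩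
  have hz : z ∈ Set.Ioo (0 : ℝ) 1 := ⟨h0.trans_le h, h1⟩
  have hcont : ContinuousOn (fun t : ℝ => (√(1 - t))⁻¹) (Set.Ioo 0 1) :=
    ContinuousOn.inv₀ (by fun_prop) fun t ht => (Real.sqrt_pos.2 (sub_pos.2 ht.2)).ne'
  rw [chenInt_tree]
  calc intOp ε (sigmaXY T.root * chenInt ε (ofForest T.children)) z
      ≤ intOp ε (fun t => C * (√(1 - t))⁻¹) z := by
        refine intOp_le ((continuousOn_sigmaXY T.root).mul (continuousOn_chenInt hε _))
          (continuousOn_const.mul hcont) h0 h h1 fun t ht => ?_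
        have ht0 : 0 < t := h0.trans_le ht.1
        have ht1 : t < 1 := ht.2.trans_lt h1
        exact (chenInt_tree_integrand_le hx hT' ht0 (chenInt_tree_le T'
          (hT.children.of_mem hmem) h0 ht.1 ht1)).trans (hC t ⟨ht0, ht1⟩)
    _ = C * (-2 * √(1 - z) - -2 * √(1 - ε)) := by
        rw [intOp, intervalIntegral.integral_const_mul,
          intervalIntegral.integral_eq_sub_of_hasDerivAt (fun t ht => hasDerivAt_sqrt_one_sub
            (Set.ordConnected_Ioo.uIcc_subset hε hz ht).2)
            (intervalIntegrable_of_continuousOn_Ioo hcont hε hz)]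
    _ ≤ C * 2 := by
        refine mul_le_mul_of_nonneg_left ?_ hC0
        have h2 : √(1 - ε) ≤ 1 := Real.sqrt_le_one.2 (by linarith)
        linarith [Real.sqrt_nonneg (1 - z)]

theorem chenInt_bounded {F : Forest XY} (hF : ∀ T ∈ F, IsSemiconvergent {T} ∧ T.root = XY.x) :
    ∃ M, ∀ ε z, 0 < ε → ε ≤ z → z < 1 → chenInt ε (ofForest F) z ≤ M := by
  refine (chenInt_forest_induction (p := fun _ f => (∀ ε z, 0 < ε → ε ≤ z → z < 1 → 0 ≤ f ε z) ∧
    ∃ M, ∀ ε z, 0 < ε → ε ≤ z → z < 1 → f ε z ≤ M) F ?_ ?_ ?_).2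
  · exact ⟨fun _ _ _ _ _ => zero_le_one, 1, fun _ _ _ _ _ => le_rfl⟩
  · rintro _ _ f g ⟨hf, M, hM⟩ ⟨hg, M', hM'⟩
    refine ⟨fun ε z h0 h h1 => mul_nonneg (hf ε z h0 h h1) (hg ε z h0 h h1), M * M',
      fun ε z h0 h h1 => ?_⟩
    exact mul_le_mul (hM ε z h0 h h1) (hM' ε z h0 h h1) (hg ε z h0 h h1)
      ((hf ε z h0 h h1).trans (hM ε z h0 h h1))
  · exact fun T hT => ⟨fun ε z => chenInt_nonneg _, chenInt_tree_bounded (hF T hT).1 (hF T hT).2⟩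

/-! ### Shuffle arborified zeta values -/

/-- Linearity is asked only eventually and on the span: `polylog` is shown to be linear only for `0
< z < 1` and on elements whose limits in `ε` exist. -/
theorem exists_tendsto_of_linear {Ω ι : Type*} {P : Forest Ω → Prop} {l : Filter ι}
    {Z : ForestAlg Ω → ι → ℝ} (zero : ∀ᶠ i in l, Z 0 i = 0)
    (add : ∀ v ∈ forestSpan P, ∀ w ∈ forestSpan P, ∀ᶠ i in l, Z (v + w) i = Z v i + Z w i)
    (smul : ∀ (c : ℝ), ∀ v ∈ forestSpan P, ∀ᶠ i in l, Z (c • v) i = c * Z v i)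
    (forest : ∀ F, P F → ∃ c, Tendsto (Z (ofForest F)) l (𝓝 c)) {v : ForestAlg Ω}
    (hv : v ∈ forestSpan P) : ∃ c, Tendsto (Z v) l (𝓝 c) := by
  refine (forestSpan_induction (p := fun v => v ∈ forestSpan P ∧ ∃ c, Tendsto (Z v) l (𝓝 c)) hv
    (fun F hF => ⟨ofForest_mem_forestSpan hF, forest F hF⟩) ⟨zero_mem _, 0, ?_⟩ ?_ ?_).2
  · exact tendsto_const_nhds.congr' (zero.mono fun _ h => h.symm)
  · rintro v w ⟨hv, c, hc⟩ ⟨hw, d, hd⟩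
    exact ⟨add_mem hv hw, c + d, (hc.add hd).congr' ((add v hv w hw).mono fun _ h => h.symm)⟩
  · rintro c v ⟨hv, d, hd⟩
    exact ⟨Submodule.smul_mem _ c hv, c * d,
      (hd.const_mul c).congr' ((smul c v hv).mono fun _ h => h.symm)⟩

open Set in
theorem eventually_mem_Ioc {z : ℝ} (hz : 0 < z) : ∀ᶠ ε : ℝ in 𝓝[>] 0, ε ∈ Ioc 0 z :=
  Ioc_mem_nhdsGT hz

open Set in
theorem tendsto_chenInt {v : ForestAlg XY} (hv : v ∈ convShuffle) {z : ℝ}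
    (hz : z ∈ Ioo (0 : ℝ) 1) :
    Tendsto (fun ε => chenInt ε v z) (𝓝[>] 0) (𝓝 (polylog v z)) := by
  refine tendsto_nhds_limUnder ?_
  rw [convShuffle_eq] at hv
  refine exists_tendsto_of_linear (Z := fun v ε => chenInt ε v z)
    (.of_forall fun ε => by rw [chenInt_zero, Pi.zero_apply])
    (fun v _ w _ => .of_forall fun ε => by rw [chenInt_add, Pi.add_apply])
    (fun c v _ => .of_forall fun ε => by rw [chenInt_smul, Pi.smul_apply, smul_eq_mul])
    (fun F hF => ?_) hv
  obtain ⟨M, hM⟩ := chenInt_bounded hF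
  -- The integral decreases in `ε`; its negative is monotone and bounded below, hence has a right
  -- limit at `0`.
  have hmono : MonotoneOn (fun ε => -chenInt ε (ofForest F) z) (Ioo 0 z) :=
    fun ε' hε' ε hε h => neg_le_neg
      ((isIntegralLike_chenInt F).mono ε' ε z z hε'.1 h hε.2.le le_rfl hz.2)
  have hbdd : BddBelow ((fun ε => -chenInt ε (ofForest F) z) '' Ioo 0 z) := by
    refine ⟨-M, ?_⟩
    rintro _ ⟨ε, hε, rfl⟩
    exact neg_le_neg (hM ε z hε.1 hε.2.le hz.2)
  have h := (hmono.tendsto_nhdsWithin_Ioo_right (nonempty_Ioo.2 hz.1) hbdd).neg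
  simp only [neg_neg] at h
  exact ⟨_, h⟩

open Set in
-- The first of the two limits, at fixed `z`. It gives the linearity and multiplicativity of
-- `polylog` needed for the second.
theorem isAlgMorphismOn_polylog {z : ℝ} (hz : z ∈ Ioo (0 : ℝ) 1) :
    IsAlgMorphismOn convShuffle treeShuffle fun v => polylog v z := by
  refine isAlgMorphismOn_of_tendsto (Z := fun v ε => chenInt ε v z) (l := 𝓝[>] 0) ?_
    (fun v hv w hw => treeShuffle_mem_convShuffle hv hw) (fun v hv => tendsto_chenInt hv hz)
    (.of_forall fun ε => by rw [chenInt_one, Pi.one_apply])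
    (.of_forall fun ε v _ w _ => by rw [chenInt_add, Pi.add_apply])
    (.of_forall fun ε c v _ => by rw [chenInt_smul, Pi.smul_apply, smul_eq_mul])
    ((eventually_mem_Ioc hz.1).mono fun ε hε v _ w _ =>
      chenInt_treeShuffle ⟨hε.1, hε.2.trans_lt hz.2⟩ hz v w)
  rw [convShuffle_eq]
  exact ofForest_mem_forestSpan (by simp)

theorem eventually_mem_Ioo_left : ∀ᶠ z : ℝ in 𝓝[<] 1, z ∈ Set.Ioo (0 : ℝ) 1 :=
  Ioo_mem_nhdsLT one_pos

/-- Monotonicity in `z` and the bound, which is uniform in `ε`, both survive the limit `ε → 0`. -/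
theorem tendsto_polylog {v : ForestAlg XY} (hv : v ∈ convShuffle) :
    Tendsto (polylog v) (𝓝[<] 1) (𝓝 (zetaShuffle v)) := by
  refine tendsto_nhds_limUnder ?_
  have hv' := hv
  rw [convShuffle_eq] at hv'
  refine exists_tendsto_of_linear (Z := polylog) ?_ ?_ ?_ (fun F hF => ?_) hv'
  · filter_upwards [eventually_mem_Ioo_left] with z hz
    simpa using (isAlgMorphismOn_polylog hz).map_smul 0 0 (zero_mem _)
  · rw [← convShuffle_eq]
    intro v hv w hw
    filter_upwards [eventually_mem_Ioo_left] with z hz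
    exact (isAlgMorphismOn_polylog hz).map_add v hv w hw
  · rw [← convShuffle_eq]
    intro c v hv
    filter_upwards [eventually_mem_Ioo_left] with z hz
    exact (isAlgMorphismOn_polylog hz).map_smul c v hv
  · obtain ⟨M, hM⟩ := chenInt_bounded hF
    have hmem : ofForest F ∈ convShuffle := by
      rw [convShuffle_eq]
      exact ofForest_mem_forestSpan hF
    have hmono : MonotoneOn (polylog (ofForest F)) (Set.Ioo 0 1) := by
      intro z hz z' hz' h
      refine le_of_tendsto_of_tendsto (tendsto_chenInt hmem hz) (tendsto_chenInt hmem hz') ?_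
      filter_upwards [eventually_mem_Ioc hz.1] with ε hε
      exact (isIntegralLike_chenInt F).mono ε ε z z' hε.1 le_rfl hε.2 h hz'.2
    have hbdd : BddAbove (polylog (ofForest F) '' Set.Ioo 0 1) := by
      refine ⟨M, ?_⟩
      rintro _ ⟨z, hz, rfl⟩
      refine le_of_tendsto (tendsto_chenInt hmem hz) ?_
      filter_upwards [eventually_mem_Ioc hz.1] with ε hε
      exact hM ε z hε.1 hε.2 hz.2
    exact ⟨_, hmono.tendsto_nhdsWithin_Ioo_left (Set.nonempty_Ioo.2 one_pos) hbdd⟩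

theorem isAlgMorphismOn_zetaShuffle : IsAlgMorphismOn convShuffle treeShuffle zetaShuffle := by
  refine isAlgMorphismOn_of_tendsto (Z := polylog) (l := 𝓝[<] 1)
    (isAlgMorphismOn_polylog (z := 1 / 2) (by norm_num)).unit_mem
    (fun v hv w hw => treeShuffle_mem_convShuffle hv hw) (fun v hv => tendsto_polylog hv)
    ?_ ?_ ?_ ?_ <;>
    filter_upwards [eventually_mem_Ioo_left] with z hz
  exacts [(isAlgMorphismOn_polylog hz).map_unit, (isAlgMorphismOn_polylog hz).map_add,
    (isAlgMorphismOn_polylog hz).map_smul, (isAlgMorphismOn_polylog hz).map_mul]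

end ArboZeta

open ArboZeta in
theorem theorem4 :
    ((∀ v ∈ convStuffle, Tendsto (partialStuffle v) atTop (𝓝 (zetaStuffle v))) ∧
      IsAlgMorphismOn convStuffle treeStuffle zetaStuffle) ∧
    ((∀ v ∈ convStuffle, Tendsto (partialStuffleStar v) atTop (𝓝 (zetaStuffleStar v))) ∧
      IsAlgMorphismOn convStuffle treeAntiStuffle zetaStuffleStar) ∧
    ((∀ v ∈ convShuffle,
        (∀ z ∈ Set.Ioo (0 : ℝ) 1,
          Tendsto (fun ε => chenInt ε v z) (𝓝[>] 0) (𝓝 (polylog v z))) ∧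
        Tendsto (polylog v) (𝓝[<] 1) (𝓝 (zetaShuffle v))) ∧
      IsAlgMorphismOn convShuffle treeShuffle zetaShuffle) :=
  ⟨⟨fun _ hv => tendsto_partialStuffle hv, isAlgMorphismOn_zetaStuffle⟩,
    ⟨fun _ hv => tendsto_partialStuffleStar hv, isAlgMorphismOn_zetaStuffleStar⟩,
    fun _ hv => ⟨fun _ hz => tendsto_chenInt hv hz, tendsto_polylog hv⟩,
    isAlgMorphismOn_zetaShuffle⟩
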